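/- Let $A\in\mathbb C(z)$ be a rational function of degree $n\ge 2$, regarded as a self-map of $\mathbb{CP}^1$, which is not conjugate by a Möbius transformation to $z^{n}$ or to $z^{-n}$. Write $A^{\circ k}$ for the $k$-th iterate of $A$. For a rational function $B$, let $\Sigma(B)$ be the group of Möbius transformations $\sigma$ with $B\circ\sigma=B$, and let $\mathrm{Aut}(B)$ be the group of Möbius transformations $\sigma$ with $B\circ\sigma=\sigma\circ B$. Put $$\Sigma_\infty(A)=\bigcup_{k\ge 1}\Sigma(A^{\circ k}),\qquad \mathrm{Aut}_\infty(A)=\bigcup_{k\ge 1}\mathrm{Aut}(A^{\circ k}).$$ For a fixed point $z_0$ of $B$ and a point $z_1\ne z_0$ of $\mathbb{CP}^1$, let $G(B,z_0,z_1)$ be the group of Möbius transformations $\sigma$ such that $\sigma(z_0)=z_0$, $\sigma(z_1)=z_1$ and $B\circ\sigma=\sigma^{\circ m}\circ B$ for some $m\ge 1$. Let $k\ge 1$, and let $\sigma$ be a Möbius transformation of finite order $l>5$ with fixed points $z_0\neq z_1$, such that $A^{\circ k}(z_0)=z_0$. 1. If $\sigma\in\mathrm{Aut}(A^{\circ k})$,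 then the groups $\mathrm{Aut}_\infty(A)$ and $G(A^{\circ k},z_0,z_1)$ are finite and $|\mathrm{Aut}_\infty(A)|\le 2\,|G(A^{\circ k},z_0,z_1)|$. 2. If $\sigma\in\Sigma(A^{\circ k})$, then the groups $\Sigma_\infty(A)$ and $G(A^{\circ k},z_0,z_1)$ are finite and $|\Sigma_\infty(A)|\le 2\,|G(A^{\circ k},z_0,z_1)|$. -/

import Mathlib

open scoped OnePoint

noncomputable section

namespace RationalDynamics

/-- The Riemann sphere, i.e. the complex projective line. -/
abbrev Sphere : Type := OnePoint ℂ

/-- The self-map of the sphere induced by a rational function `A = P / Q` in lowest terms: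
a finite point `z` goes to `P z / Q z` (to `∞` if `Q z = 0`), and `∞` goes to the limit of
`P z / Q z` as `z → ∞`. -/
def toMap (A : RatFunc ℂ) : Sphere → Sphere
  | none =>
      if A.denom.natDegree < A.num.natDegree then ∞
      else ((A.num.coeff A.denom.natDegree / A.denom.leadingCoeff : ℂ) : Sphere)
  | some z =>
      if A.denom.eval z = 0 then ∞
      else ((A.num.eval z / A.denom.eval z : ℂ) : Sphere)

/-- The degree of a rational function `A = P / Q` in lowest terms, `max (deg P) (deg Q)`. -/
def degree (A : RatFunc ℂ) : ℕ := max A.num.natDegree A.denom.natDegree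

/-- The group of Möbius transformations `z ↦ (a z + b) / (c z + d)`, `a d - b c ≠ 0`, as a group of
permutations of the sphere. -/
def Moebius : Subgroup (Equiv.Perm Sphere) :=
  (MulAction.toPermHom (GL (Fin 2) ℂ) Sphere).range

/-- `A`, of degree `n`, is conjugate to `z ^ n` or to `z ^ (-n)` by a Möbius transformation. -/
def IsConjugateToPower (A : RatFunc ℂ) : Prop :=
  ∃ β : Moebius,
    (∀ z : Sphere, β • toMap A z = toMap (RatFunc.X ^ degree A) (β • z)) ∨
    (∀ z : Sphere, β • toMap A z = toMap ((RatFunc.X ^ degree A)⁻¹) (β • z))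

/-- `G(f)`: the Möbius transformations `σ` with `f ∘ σ = ν ∘ f` for some Möbius `ν`. -/
def symG (f : Sphere → Sphere) : Subgroup Moebius where
  carrier := {σ | ∃ ν : Moebius, ∀ z, f (σ • z) = ν • f z}
  one_mem' := ⟨1, fun z => by simp⟩
  mul_mem' := by
    rintro a b ⟨ν, hν⟩ ⟨μ, hμ⟩
    exact ⟨ν * μ, fun z => by rw [mul_smul, mul_smul, hν, hμ]⟩
  inv_mem' := by
    rintro a ⟨ν, hν⟩
    exact ⟨ν⁻¹, fun z => by rw [eq_inv_smul_iff, ← hν, smul_inv_smul]⟩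

/-- `Σ(f)`: the Möbius transformations `σ` with `f ∘ σ = f`. -/
def symSigma (f : Sphere → Sphere) : Subgroup Moebius where
  carrier := {σ | ∀ z, f (σ • z) = f z}
  one_mem' := fun z => by simp
  mul_mem' := by
    intro a b ha hb z
    rw [mul_smul, ha, hb]
  inv_mem' := by
    intro a ha z
    rw [← ha, smul_inv_smul]

/-- `Aut(f)`: the Möbius transformations `σ` with `f ∘ σ = σ ∘ f`. -/
def symAut (f : Sphere → Sphere) : Subgroup Moebius where
  carrier := {σ | ∀ z, f (σ • z) = σ • f z}
  one_mem' := fun z => by simp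
  mul_mem' := by
    intro a b ha hb z
    rw [mul_smul, mul_smul, ha, hb]
  inv_mem' := by
    intro a ha z
    rw [eq_inv_smul_iff, ← ha, smul_inv_smul]

/-- `Σ_∞(f)`, the union of the groups `Σ(f^{∘k})` over `k ≥ 1`. -/
def sigmaInf (f : Sphere → Sphere) : Set Moebius :=
  ⋃ k : ℕ, ⋃ _ : 1 ≤ k, (symSigma f^[k] : Set Moebius)

/-- `Aut_∞(f)`, the union of the groups `Aut(f^{∘k})` over `k ≥ 1`. -/
def autInf (f : Sphere → Sphere) : Set Moebius :=
  ⋃ k : ℕ, ⋃ _ : 1 ≤ k, (symAut f^[k] : Set Moebius)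

/-- `G(f, z₀, z₁)`: the elements `σ` of `G(f)` which fix `z₀` and `z₁` and for which
the Möbius transformation `ν` with `f ∘ σ = ν ∘ f` is a power `σ^{∘m}`, `m ≥ 1`.
It is used only for `f z₀ = z₀` and `z₁ ≠ z₀`. -/
def localG (f : Sphere → Sphere) (z₀ z₁ : Sphere) : Set Moebius :=
  {σ | σ ∈ symG f ∧ σ • z₀ = z₀ ∧ σ • z₁ = z₁ ∧
    ∃ m : ℕ, 1 ≤ m ∧ ∀ z, f (σ • z) = (σ ^ m) • f z}

end RationalDynamics

end

/-!
Both `Σ_∞(A)` and `Aut_∞(A)` are directed unions of finite groups, and replacing `A` by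
`B = A^{∘k}` does not change them: `Σ(B)` is finite because a Möbius transformation is determined
by the images of three points and the fibres of `B` are finite, `Aut(B)` because it permutes the
fixed points of `B` and their preimages of order two, among which there are at least three.

In a finite group of Möbius transformations containing `σ`, the stabilizer of `z₀` has order at
least six, and the orbit count `∑ (1 - 1 / |stabilizer|) = 2 - 2 / |group|` leaves at most two
points in the orbit of `z₀`. Hence every `τ` in the union maps `z₀` to `z₀` or `z₁`, and those
fixing `z₀` have index at most two.

A `τ` fixing `z₀` also fixes `z₁`, hence is `z ↦ ε z` in a coordinate with `z₀ = 0` and `z₁ = ∞`.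
Comparing leading terms of germs at `0`, the relation `B^{∘j}(ε z) = ε ^ m B^{∘j}(z)` descends to
`B(ε z) = ε ^ s B(z)`, where `s` is the order of vanishing of `B`; so `τ` lies in `G(B, z₀, z₁)`.
That set is finite: two terms of different orders in the expansion of `B` make `ε` a root of unity
of bounded order, and a monomial germ would make `A` conjugate to `z ^ n` or `z ^ (-n)`.
-/

noncomputable section

namespace RationalDynamics

section Coordinates

open Matrix

variable {K : Type*} [Field K] {v w : Fin 2 → K}

lemma ne_zero_iff_apply : v ≠ 0 ↔ v 0 ≠ 0 ∨ v 1 ≠ 0 := by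
  simp only [ne_eq, funext_iff, Fin.forall_fin_two, Pi.zero_apply, not_and_or]

variable [DecidableEq K]

/-- The point of the projective line with homogeneous coordinates `[v 0 : v 1]`.
The value at `v = 0`, which represents no point, is `∞`. -/
def pt (v : Fin 2 → K) : OnePoint K := if v 1 = 0 then ∞ else ((v 0 / v 1 : K) : OnePoint K)

lemma pt_coe (z : K) : pt ![z, 1] = (z : OnePoint K) := by simp [pt]

lemma pt_eq_infty_iff : pt v = ∞ ↔ v 1 = 0 := by
  unfold pt
  split_ifs with h <;> simp [h]

lemma exists_pt_eq (z : OnePoint K) : ∃ v : Fin 2 → K, v ≠ 0 ∧ pt v = z := by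
  induction z using OnePoint.rec with
  | infty => exact ⟨![1, 0], by simp, by simp [pt]⟩
  | coe z => exact ⟨![z, 1], by simp, pt_coe z⟩

lemma pt_eq_pt_iff (hv : v ≠ 0) (hw : w ≠ 0) : pt v = pt w ↔ v 0 * w 1 = w 0 * v 1 := by
  rw [ne_zero_iff_apply] at hv hw
  unfold pt
  split_ifs with h h' h' <;> simp_all [div_eq_div_iff]

lemma pt_eq_zero_iff (hv : v ≠ 0) : pt v = ((0 : K) : OnePoint K) ↔ v 0 = 0 := by
  rw [← pt_coe, pt_eq_pt_iff hv (by simp)]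
  simp

lemma pt_smul {t : K} (ht : t ≠ 0) (v : Fin 2 → K) : pt (t • v) = pt v := by
  simp [pt, ht, mul_div_mul_left]

lemma equivProjectivization_pt (hv : v ≠ 0) :
    OnePoint.equivProjectivization K (pt v) = Projectivization.mk K v hv := by
  rw [← Equiv.eq_symm_apply, OnePoint.equivProjectivization_symm_apply_mk, pt]
  simp only [div_eq_inv_mul]

lemma smul_pt (M : GL (Fin 2) K) (hv : v ≠ 0) : M • pt v = pt (M • v) := by
  apply (OnePoint.equivProjectivization K).injective
  rw [OnePoint.equivProjectivization_smul, equivProjectivization_pt hv,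
    equivProjectivization_pt ((smul_ne_zero_iff_ne M).2 hv), Projectivization.smul_mk]

lemma exists_gl_smul_eq_zero_infty {z₀ z₁ : OnePoint K} (h : z₀ ≠ z₁) :
    ∃ M : GL (Fin 2) K, M • z₀ = ((0 : K) : OnePoint K) ∧ M • z₁ = ∞ := by
  obtain ⟨v, hv, rfl⟩ := exists_pt_eq z₀
  obtain ⟨w, hw, rfl⟩ := exists_pt_eq z₁
  rw [Ne, pt_eq_pt_iff hv hw] at h
  let M : GL (Fin 2) K := Matrix.GeneralLinearGroup.mkOfDetNeZero !![v 1, -v 0; w 1, -w 0] (by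
    rw [Matrix.det_fin_two_of]
    exact fun h' => h (by linear_combination h'))
  refine ⟨M, ?_, ?_⟩
  · rw [smul_pt M hv, pt_eq_zero_iff ((smul_ne_zero_iff_ne M).2 hv)]
    simp [M, Matrix.GeneralLinearGroup.mkOfDetNeZero, mul_comm]
  · rw [smul_pt M hw, pt_eq_infty_iff]
    simp [M, Matrix.GeneralLinearGroup.mkOfDetNeZero, mul_comm]

lemma exists_affine_of_gl_smul_infty {M : GL (Fin 2) K} (h : M • (∞ : OnePoint K) = ∞) :
    ∃ a b : K, a ≠ 0 ∧ ∀ z : K, M • (z : OnePoint K) = ((a * z + b : K) : OnePoint K) := by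
  rw [OnePoint.smul_infty_eq_self_iff] at h
  have hdet := M.det_ne_zero
  simp only [Matrix.det_fin_two, h, mul_zero, sub_zero, mul_ne_zero_iff] at hdet
  refine ⟨M 0 0 / M 1 1, M 0 1 / M 1 1, div_ne_zero hdet.1 hdet.2, fun z => ?_⟩
  rw [OnePoint.smul_some_eq_ite]
  simp only [h, zero_mul, zero_add, hdet.2, if_false]
  congr 1
  ring

lemma exists_gl_smul_eq_self [IsAlgClosed K] (M : GL (Fin 2) K) : ∃ z : OnePoint K, M • z = z := by
  by_cases hc : M 1 0 = 0
  · exact ⟨∞, OnePoint.smul_infty_eq_self_iff.2 hc⟩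
  · have hdeg : M.fixpointPolynomial.degree ≠ 0 := by
      rw [Matrix.GeneralLinearGroup.fixpointPolynomial, sub_eq_add_neg, ← Polynomial.C_neg,
        Polynomial.degree_quadratic hc]
      decide
    obtain ⟨z, hz⟩ := IsAlgClosed.exists_root _ hdeg
    exact ⟨z, Matrix.GeneralLinearGroup.fixpointPolynomial_aeval_eq_zero_iff.1 hz⟩

end Coordinates

section Moebius

lemma moebius_ext {g h : Moebius} (H : ∀ z : Sphere, g • z = h • z) : g = h :=
  Subtype.ext (Equiv.ext H)

lemma exists_gl_smul_eq (g : Moebius) : ∃ M : GL (Fin 2) ℂ, ∀ z : Sphere, g • z = M • z := by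
  obtain ⟨_, M, rfl⟩ := g
  exact ⟨M, fun _ => rfl⟩

lemma exists_smul_eq_zero_infty {z₀ z₁ : Sphere} (h : z₀ ≠ z₁) :
    ∃ β : Moebius, β • z₀ = ((0 : ℂ) : Sphere) ∧ β • z₁ = ∞ := by
  obtain ⟨M, hM⟩ := exists_gl_smul_eq_zero_infty h
  exact ⟨⟨_, M, rfl⟩, hM⟩

lemma exists_smul_eq_infty (z : Sphere) : ∃ β : Moebius, β • z = ∞ := by
  obtain ⟨w, hw⟩ := exists_ne z
  exact (exists_smul_eq_zero_infty hw).imp fun _ h => h.2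

lemma exists_affine_of_smul_infty {g : Moebius} (h : g • (∞ : Sphere) = ∞) :
    ∃ a b : ℂ, a ≠ 0 ∧ ∀ z : ℂ, g • (z : Sphere) = ((a * z + b : ℂ) : Sphere) := by
  obtain ⟨M, hM⟩ := exists_gl_smul_eq g
  simp only [hM] at h ⊢
  exact exists_affine_of_gl_smul_infty h

lemma exists_homothety_of_smul_zero_infty {g : Moebius}
    (h0 : g • ((0 : ℂ) : Sphere) = ((0 : ℂ) : Sphere)) (h1 : g • (∞ : Sphere) = ∞) :
    ∃ ε : ℂ, ε ≠ 0 ∧ ∀ z : ℂ, g • (z : Sphere) = ((ε * z : ℂ) : Sphere) := by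
  obtain ⟨a, b, ha, hg⟩ := exists_affine_of_smul_infty h1
  have hb : b = 0 := by simpa [hg] using h0
  exact ⟨a, ha, by simpa [hb] using hg⟩

lemma eq_one_of_smul_coe {g : Moebius} (h1 : g • (∞ : Sphere) = ∞)
    (h : ∀ z : ℂ, g • (z : Sphere) = (z : Sphere)) : g = 1 :=
  moebius_ext fun z => by
    rw [one_smul]
    cases z
    exacts [h1, h _]

lemma eq_one_of_smul_eq_self_of_three {g : Moebius} {p q r : Sphere} (hpq : p ≠ q) (hpr : p ≠ r)
    (hqr : q ≠ r) (hp : g • p = p) (hq : g • q = q) (hr : g • r = r) : g = 1 := by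
  obtain ⟨β, h0, h1⟩ := exists_smul_eq_zero_infty hpq
  have hfix {z : Sphere} (hz : g • z = z) : (β * g * β⁻¹) • β • z = β • z := by
    simp only [mul_smul, inv_smul_smul, hz]
  have h1' : (β * g * β⁻¹) • (∞ : Sphere) = ∞ := h1 ▸ hfix hq
  obtain ⟨ε, -, hε⟩ := exists_homothety_of_smul_zero_infty (h0 ▸ hfix hp) h1'
  obtain ⟨w, hw⟩ : ∃ w : ℂ, (w : Sphere) = β • r :=
    OnePoint.ne_infty_iff_exists.1 (h1 ▸ (MulAction.injective β).ne hqr.symm)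
  have hw0 : w ≠ 0 := by
    rintro rfl
    exact hpr (smul_left_cancel β (h0.trans hw))
  have hε1 : ε = 1 := by
    have hr' := hfix hr
    rw [← hw, hε, OnePoint.coe_eq_coe] at hr'
    exact (mul_eq_right₀ hw0).1 hr'
  have : β * g * β⁻¹ = 1 := eq_one_of_smul_coe h1' (by simpa [hε1] using hε)
  simpa [mul_inv_eq_one] using this

lemma finite_of_finite_image_of_three {S : Set Moebius} {p q r : Sphere} (hpq : p ≠ q)
    (hpr : p ≠ r) (hqr : q ≠ r) (hp : ((· • p) '' S).Finite) (hq : ((· • q) '' S).Finite)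
    (hr : ((· • r) '' S).Finite) : S.Finite := by
  refine Set.Finite.of_finite_image (f := fun g => (g • p, g • q, g • r))
    ((hp.prod (hq.prod hr)).subset ?_) ?_
  · rintro _ ⟨g, hg, rfl⟩
    exact ⟨⟨g, hg, rfl⟩, ⟨g, hg, rfl⟩, ⟨g, hg, rfl⟩⟩
  · intro g _ h _ hgh
    simp only [Prod.mk.injEq] at hgh
    refine (inv_mul_eq_one.1 <| eq_one_of_smul_eq_self_of_three (g := g⁻¹ * h) hpq hpr hqr ?_ ?_ ?_)
    all_goals simp only [mul_smul, inv_smul_eq_iff, hgh]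

lemma exists_smul_eq_self (g : Moebius) : ∃ z : Sphere, g • z = z := by
  obtain ⟨M, hM⟩ := exists_gl_smul_eq g
  simpa only [hM] using exists_gl_smul_eq_self M

lemma ncard_fixedBy_of_smul_infty {g : Moebius} (hg : IsOfFinOrder g) (hg1 : g ≠ 1)
    (h1 : g • (∞ : Sphere) = ∞) : (MulAction.fixedBy Sphere g).ncard = 2 := by
  obtain ⟨a, b, ha, hab⟩ := exists_affine_of_smul_infty h1
  have ha1 : a ≠ 1 := by
    rintro rfl
    have htrans (n : ℕ) : g ^ n • ((0 : ℂ) : Sphere) = ((n * b : ℂ) : Sphere) := by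
      induction n with
      | zero => simp
      | succ n ih =>
        rw [pow_succ', mul_smul, ih, hab]
        push_cast
        ring_nf
    have hb : b = 0 := by
      have h := htrans (orderOf g)
      rw [pow_orderOf_eq_one, one_smul, OnePoint.coe_eq_coe, eq_comm, mul_eq_zero] at h
      exact h.resolve_left (by exact_mod_cast hg.orderOf_pos.ne')
    exact hg1 (eq_one_of_smul_coe h1 (by simpa [hb] using hab))
  have hfix : MulAction.fixedBy Sphere g = {∞, ((b / (1 - a) : ℂ) : Sphere)} := by
    ext z
    induction z using OnePoint.rec with
    | infty => simpa using h1
    | coe z =>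
      have : (1 : ℂ) - a ≠ 0 := sub_ne_zero.2 ha1.symm
      simp only [MulAction.mem_fixedBy, hab, OnePoint.coe_eq_coe, Set.mem_insert_iff,
        Set.mem_singleton_iff, OnePoint.coe_ne_infty, false_or, eq_div_iff this]
      grind
  rw [hfix, Set.ncard_pair (OnePoint.infty_ne_coe _)]

lemma ncard_fixedBy {g : Moebius} (hg : IsOfFinOrder g) (hg1 : g ≠ 1) :
    (MulAction.fixedBy Sphere g).ncard = 2 := by
  obtain ⟨p, hp⟩ := exists_smul_eq_self g
  obtain ⟨β, hβ⟩ := exists_smul_eq_infty p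
  rw [← Set.ncard_smul_set β, MulAction.smul_fixedBy]
  refine ncard_fixedBy_of_smul_infty ?_ (by simpa [mul_inv_eq_one] using hg1) ?_
  · obtain ⟨n, hn, h⟩ := isOfFinOrder_iff_pow_eq_one.1 hg
    exact isOfFinOrder_iff_pow_eq_one.2 ⟨n, hn, by simp [conj_pow, h]⟩
  · simp only [← hβ, mul_smul, inv_smul_smul, hp]

end Moebius

section BinaryForms

open MvPolynomial

variable {K : Type*} [Field K] {F : MvPolynomial (Fin 2) K} {N : ℕ}

lemma exists_eq_homogenize (hF : F.IsHomogeneous N) :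
    ∃ p : Polynomial K, p.natDegree ≤ N ∧ p.homogenize N = F :=
  ⟨aeval ![Polynomial.X, 1] F, by
    simpa using aeval_natDegree_le (n := 1) F hF.totalDegree_le ![Polynomial.X, 1]
      (by simp [Fin.forall_fin_two]),
    Polynomial.homogenize_eq_of_isHomogeneous hF rfl⟩

lemma eval_homogenize_coe {p : Polynomial K} (hp : p.natDegree ≤ N) (z : K) :
    eval ![z, 1] (p.homogenize N) = p.eval z := by
  simpa using Polynomial.eval_homogenize hp ![z, 1] (by simp)

lemma eval_homogenize_of_apply_one_eq_zero (p : Polynomial K) {v : Fin 2 → K} (hv : v 1 = 0) :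
    eval v (p.homogenize N) = p.coeff N * v 0 ^ N := by
  rw [Polynomial.homogenize, map_sum, Finset.sum_eq_single (N, 0)]
  · simp [eval_monomial, Finsupp.prod_fintype]
  · rintro ⟨i, j⟩ hij hne
    have hj : j ≠ 0 := by
      rintro rfl
      exact hne (by simpa using hij)
    simp [eval_monomial, Finsupp.prod_fintype, hv, hj]
  · simp

lemma finite_setOf_eval_eq_zero [DecidableEq K] (hF : F.IsHomogeneous N) (hF0 : F ≠ 0) :
    {z : OnePoint K | ∃ v, v ≠ 0 ∧ pt v = z ∧ eval v F = 0}.Finite := by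
  obtain ⟨p, hp, rfl⟩ := exists_eq_homogenize hF
  have hp0 : p ≠ 0 := by rintro rfl; exact hF0 (by simp)
  refine (((p.roots.toFinset.finite_toSet).image ((↑) : K → OnePoint K)).insert ∞).subset ?_
  rintro _ ⟨v, -, rfl, hv⟩
  by_cases h1 : v 1 = 0
  · exact Or.inl (pt_eq_infty_iff.2 h1)
  · rw [Polynomial.eval_homogenize hp v h1, mul_eq_zero, or_iff_left (pow_ne_zero _ h1)] at hv
    refine Or.inr ⟨v 0 / v 1, by simpa [hp0] using hv, by simp [pt, h1]⟩

variable [IsAlgClosed K]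

lemma exists_eval_eq_zero (hF : F.IsHomogeneous N) (hN : N ≠ 0) : ∃ v, v ≠ 0 ∧ eval v F = 0 := by
  obtain ⟨p, hp, rfl⟩ := exists_eq_homogenize hF
  by_cases h : p.coeff N = 0
  · exact ⟨![1, 0], by simp, by simp [eval_homogenize_of_apply_one_eq_zero, h]⟩
  · obtain ⟨z, hz⟩ := IsAlgClosed.exists_root p fun hd =>
      h (Polynomial.coeff_eq_zero_of_degree_lt (by rw [hd]; exact_mod_cast hN.bot_lt))
    exact ⟨![z, 1], by simp, by rw [eval_homogenize_coe hp, hz]⟩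

lemma eq_C_mul_X_zero_pow (hF : F.IsHomogeneous N) (h : ∀ v, v ≠ 0 → eval v F = 0 → v 0 = 0) :
    ∃ c, c ≠ 0 ∧ F = C c * X 0 ^ N := by
  obtain ⟨p, hp, rfl⟩ := exists_eq_homogenize hF
  have hpN : p.coeff N ≠ 0 := fun h0 => one_ne_zero (α := K) <|
    h ![1, 0] (by simp) (by simp [eval_homogenize_of_apply_one_eq_zero, h0])
  have hdeg : p.natDegree = N := hp.antisymm (Polynomial.le_natDegree_of_ne_zero hpN)
  have hroots : p.roots = Multiset.replicate N 0 := by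
    refine Multiset.eq_replicate.2
      ⟨by rw [← hdeg, (IsAlgClosed.splits p).natDegree_eq_card_roots], fun z hz => ?_⟩
    exact h ![z, 1] (by simp) (by rw [eval_homogenize_coe hp, Polynomial.isRoot_of_mem_roots hz])
  have hpX : p = Polynomial.C p.leadingCoeff * Polynomial.X ^ N := by
    simpa [hroots] using (IsAlgClosed.splits p).eq_prod_roots
  refine ⟨p.leadingCoeff, by rwa [Polynomial.leadingCoeff, hdeg], ?_⟩
  conv_lhs => rw [hpX]
  rw [Polynomial.homogenize_C_mul, Polynomial.homogenize_X_pow le_rfl, Nat.sub_self, pow_zero,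
    mul_one]

lemma eq_C_mul_X_one_pow (hF : F.IsHomogeneous N) (h : ∀ v, v ≠ 0 → eval v F = 0 → v 1 = 0) :
    ∃ c, c ≠ 0 ∧ F = C c * X 1 ^ N := by
  obtain ⟨p, hp, rfl⟩ := exists_eq_homogenize hF
  have hroot (z : K) : p.eval z ≠ 0 := fun hz => one_ne_zero (α := K) <|
    h ![z, 1] (by simp) (by rw [eval_homogenize_coe hp, hz])
  have hdeg : p.degree = 0 := by
    by_contra hd
    obtain ⟨z, hz⟩ := IsAlgClosed.exists_root p hd
    exact hroot z hz
  rw [Polynomial.eq_C_of_degree_eq_zero hdeg] at hroot ⊢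
  exact ⟨p.coeff 0, by simpa using hroot 0, Polynomial.homogenize_C _ _⟩

end BinaryForms

lemma exists_pow_ne_self {K : Type*} [Field K] [IsAlgClosed K] {N : ℕ} (hN : 2 ≤ N) :
    ∃ z : K, z ≠ z ^ N := by
  obtain ⟨a, ha⟩ := (Set.toFinite ({0, 1} : Set K)).exists_notMem
  simp only [Set.mem_insert_iff, Set.mem_singleton_iff, not_or] at ha
  obtain ⟨z, rfl⟩ := IsAlgClosed.exists_pow_nat_eq a (n := N - 1) (by omega)
  have hz : z ≠ 0 := by
    rintro rfl
    exact ha.1 (zero_pow (by omega))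
  refine ⟨z, fun h => ha.2 (mul_left_cancel₀ hz ?_)⟩
  rw [mul_pow_sub_one (by omega), mul_one, ← h]

section RationalMaps

open MvPolynomial

variable {K : Type*} [Field K] [DecidableEq K] {f g : OnePoint K → OnePoint K} {N M : ℕ}

/-- The polynomial self-map of the plane with components `F 0` and `F 1`. -/
def polyMap (F : Fin 2 → MvPolynomial (Fin 2) K) (v : Fin 2 → K) : Fin 2 → K :=
  fun i => eval v (F i)

/-- The self-map `f` of the projective line is rational of degree `N`: in homogeneous coordinates
it is given by two forms of degree `N` without a common zero. -/
def IsRational (f : OnePoint K → OnePoint K) (N : ℕ) : Prop :=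
  ∃ F : Fin 2 → MvPolynomial (Fin 2) K, (∀ i, (F i).IsHomogeneous N) ∧
    ∀ v, v ≠ 0 → polyMap F v ≠ 0 ∧ f (pt v) = pt (polyMap F v)

lemma isRational_gl_smul (M : GL (Fin 2) K) :
    IsRational (fun z : OnePoint K => M • z) 1 := by
  have hM (v : Fin 2 → K) : polyMap (fun i => C (M i 0) * X 0 + C (M i 1) * X 1) v = M • v := by
    ext i
    fin_cases i <;> simp [polyMap]
  refine ⟨fun i => C (M i 0) * X 0 + C (M i 1) * X 1,
    fun i => ((isHomogeneous_X K 0).C_mul _).add ((isHomogeneous_X K 1).C_mul _), fun v hv => ?_⟩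
  rw [hM]
  exact ⟨(smul_ne_zero_iff_ne M).2 hv, smul_pt M hv⟩

lemma isRational_id : IsRational (id : OnePoint K → OnePoint K) 1 := by
  simpa only [one_smul, Function.id_def] using isRational_gl_smul (1 : GL (Fin 2) K)

lemma isRational_const (w : OnePoint K) : IsRational (fun _ : OnePoint K => w) 0 := by
  obtain ⟨v, hv, rfl⟩ := exists_pt_eq w
  have hC (u : Fin 2 → K) : polyMap (fun i => C (v i)) u = v := by
    ext i
    simp [polyMap]
  exact ⟨fun i => C (v i), fun i => isHomogeneous_C _ _, fun u _ => by rw [hC]; exact ⟨hv, rfl⟩⟩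

lemma IsRational.comp (hf : IsRational f N) (hg : IsRational g M) :
    IsRational (f ∘ g) (M * N) := by
  obtain ⟨F, hF, hfF⟩ := hf
  obtain ⟨G, hG, hgG⟩ := hg
  have hFG (v : Fin 2 → K) : polyMap (fun i => aeval G (F i)) v = polyMap F (polyMap G v) := by
    ext i
    exact eval₂Hom_bind₁ (RingHom.id K) v G (F i)
  refine ⟨fun i => aeval G (F i), fun i => (hF i).aeval G hG, fun v hv => ?_⟩
  obtain ⟨h0, h1⟩ := hgG v hv
  rw [hFG, Function.comp_apply, h1]
  exact hfF _ h0

lemma IsRational.iterate (hf : IsRational f N) (m : ℕ) : IsRational f^[m] (N ^ m) := by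
  induction m with
  | zero => exact isRational_id
  | succ m ih => rw [Function.iterate_succ, pow_succ']; exact ih.comp hf

lemma IsRational.eq_of_infinite (hf : IsRational f N) (hg : IsRational g M)
    (h : {z | f z = g z}.Infinite) : f = g := by
  obtain ⟨F, hF, hfF⟩ := hf
  obtain ⟨G, hG, hgG⟩ := hg
  have hiff {v : Fin 2 → K} (hv : v ≠ 0) :
      f (pt v) = g (pt v) ↔ eval v (F 0 * G 1 - G 0 * F 1) = 0 := by
    rw [(hfF v hv).2, (hgG v hv).2, pt_eq_pt_iff (hfF v hv).1 (hgG v hv).1, map_sub, map_mul,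
      map_mul, sub_eq_zero]
    rfl
  have hFG : F 0 * G 1 - G 0 * F 1 = 0 := by
    by_contra h0
    refine h ((finite_setOf_eval_eq_zero
      (((hF 0).mul (hG 1)).sub (add_comm N M ▸ (hG 0).mul (hF 1))) h0).subset fun z hz => ?_)
    obtain ⟨v, hv, rfl⟩ := exists_pt_eq z
    exact ⟨v, hv, rfl, (hiff hv).1 hz⟩
  ext z
  obtain ⟨v, hv, rfl⟩ := exists_pt_eq z
  rw [hiff hv, hFG, map_zero]

variable [IsAlgClosed K]

lemma IsRational.surjective (hf : IsRational f N) (hN : N ≠ 0) : Function.Surjective f := by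
  obtain ⟨F, hF, hfF⟩ := hf
  intro w
  obtain ⟨a, ha, rfl⟩ := exists_pt_eq w
  obtain ⟨v, hv, h⟩ := exists_eval_eq_zero
    (((hF 0).C_mul (a 1)).sub ((hF 1).C_mul (a 0))) hN
  refine ⟨pt v, ?_⟩
  rw [(hfF v hv).2, pt_eq_pt_iff (hfF v hv).1 ha]
  simp only [map_sub, map_mul, eval_C] at h
  simp only [polyMap]
  linear_combination h

lemma IsRational.finite_preimage (hf : IsRational f N) (hN : N ≠ 0) {S : Set (OnePoint K)}
    (hS : S.Finite) : (f ⁻¹' S).Finite := by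
  rw [← Set.biUnion_preimage_singleton]
  refine hS.biUnion fun w _ => by_contra fun hinf => ?_
  have hconst : f = fun _ => w := hf.eq_of_infinite (isRational_const w) hinf
  obtain ⟨z, hz⟩ := exists_ne w
  obtain ⟨y, rfl⟩ := hf.surjective hN z
  exact hz (congrFun hconst y)

lemma IsRational.eq_pow (hf : IsRational f N)
    (h0 : ∀ z, f z = ((0 : K) : OnePoint K) → z = ((0 : K) : OnePoint K))
    (h1 : ∀ z, f z = ∞ → z = ∞) :
    ∃ c : K, c ≠ 0 ∧ ∀ v, v ≠ 0 → f (pt v) = pt ![c * v 0 ^ N, v 1 ^ N] := by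
  obtain ⟨F, hF, hfF⟩ := hf
  obtain ⟨a, ha, hFa⟩ := eq_C_mul_X_zero_pow (hF 0) fun v hv h => (pt_eq_zero_iff hv).1 <|
    h0 _ (by rw [(hfF v hv).2, pt_eq_zero_iff (hfF v hv).1]; exact h)
  obtain ⟨b, hb, hFb⟩ := eq_C_mul_X_one_pow (hF 1) fun v hv h => pt_eq_infty_iff.1 <|
    h1 _ (by rw [(hfF v hv).2, pt_eq_infty_iff]; exact h)
  refine ⟨a / b, div_ne_zero ha hb, fun v hv => ?_⟩
  have hFv : polyMap F v = b • ![a / b * v 0 ^ N, v 1 ^ N] := by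
    ext i
    fin_cases i <;> simp [polyMap, hFa, hFb, ← mul_assoc, mul_div_cancel₀ _ hb]
  rw [(hfF v hv).2, hFv, pt_smul hb]

lemma IsRational.eq_inv_pow (hf : IsRational f N)
    (h0 : ∀ z, f z = ((0 : K) : OnePoint K) → z = ∞)
    (h1 : ∀ z, f z = ∞ → z = ((0 : K) : OnePoint K)) :
    ∃ c : K, c ≠ 0 ∧ ∀ v, v ≠ 0 → f (pt v) = pt ![c * v 1 ^ N, v 0 ^ N] := by
  obtain ⟨F, hF, hfF⟩ := hf
  obtain ⟨a, ha, hFa⟩ := eq_C_mul_X_one_pow (hF 0) fun v hv h => pt_eq_infty_iff.1 <|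
    h0 _ (by rw [(hfF v hv).2, pt_eq_zero_iff (hfF v hv).1]; exact h)
  obtain ⟨b, hb, hFb⟩ := eq_C_mul_X_zero_pow (hF 1) fun v hv h => (pt_eq_zero_iff hv).1 <|
    h1 _ (by rw [(hfF v hv).2, pt_eq_infty_iff]; exact h)
  refine ⟨a / b, div_ne_zero ha hb, fun v hv => ?_⟩
  have hFv : polyMap F v = b • ![a / b * v 1 ^ N, v 0 ^ N] := by
    ext i
    fin_cases i <;> simp [polyMap, hFa, hFb, ← mul_assoc, mul_div_cancel₀ _ hb]
  rw [(hfF v hv).2, hFv, pt_smul hb]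

lemma IsRational.finite_setOf_fixed (hf : IsRational f N) (hN : 2 ≤ N) :
    {z | f z = z}.Finite := by
  by_contra hinf
  obtain rfl : f = id := hf.eq_of_infinite isRational_id hinf
  obtain ⟨c, -, hc⟩ := hf.eq_pow (fun _ => id) fun _ => id
  have hpow (z : K) : z = c * z ^ N := by
    simpa [pt_coe] using hc ![z, 1] (by simp)
  obtain rfl : c = 1 := by simpa using (hpow 1).symm
  obtain ⟨z, hz⟩ := exists_pow_ne_self (K := K) hN
  exact hz (by simpa using hpow z)

lemma IsRational.exists_fixed_ne_infty (hf : IsRational f N) (hN : 2 ≤ N)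
    (h : ∀ z, f z = ∞ → z = ∞) : ∃ z, z ≠ ∞ ∧ f z = z := by
  obtain ⟨F, hF, hfF⟩ := hf
  obtain ⟨c, -, hFc⟩ := eq_C_mul_X_one_pow (hF 1) fun v hv hv' => pt_eq_infty_iff.1 <|
    h _ (by rw [(hfF v hv).2, pt_eq_infty_iff]; exact hv')
  obtain ⟨n, rfl⟩ : ∃ n, N = n + 2 := ⟨N - 2, by omega⟩
  have hX : (X 0 * X 1 ^ (n + 1) : MvPolynomial (Fin 2) K).IsHomogeneous (n + 2) := by
    rw [show n + 2 = 1 + 1 * (n + 1) by ring]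
    exact (isHomogeneous_X K 0).mul ((isHomogeneous_X K 1).pow (n + 1))
  obtain ⟨v, hv, hv0⟩ := exists_eval_eq_zero ((hF 0).sub (hX.C_mul c)) (by omega)
  obtain ⟨hFv, hfv⟩ := hfF v hv
  have hF1 : polyMap F v 1 = c * v 1 ^ (n + 2) := by simp [polyMap, hFc]
  have hF0 : polyMap F v 0 = c * (v 0 * v 1 ^ (n + 1)) := by
    simpa [polyMap, sub_eq_zero] using hv0
  refine ⟨pt v, fun hinf => ?_, ?_⟩
  · rw [pt_eq_infty_iff] at hinf
    exact (ne_zero_iff_apply.1 hFv).elim (by simp [hF0, hinf]) (by simp [hF1, hinf])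
  · rw [hfv, pt_eq_pt_iff hFv hv, hF0, hF1]
    ring

end RationalMaps

section RatFuncMaps

lemma toMap_pt (A : RatFunc ℂ) {v : Fin 2 → ℂ} (hv : v ≠ 0) :
    toMap A (pt v) =
      pt (polyMap ![A.num.homogenize (degree A), A.denom.homogenize (degree A)] v) := by
  have hP : A.num.natDegree ≤ degree A := le_max_left _ _
  have hQ : A.denom.natDegree ≤ degree A := le_max_right _ _
  by_cases h1 : v 1 = 0
  · have h0 : v 0 ≠ 0 := (ne_zero_iff_apply.1 hv).resolve_right (not_not.2 h1)
    have hlhs : toMap A (pt v) = if A.denom.natDegree < A.num.natDegree then ∞ else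
        ((A.num.coeff A.denom.natDegree / A.denom.leadingCoeff : ℂ) : Sphere) := by
      rw [pt_eq_infty_iff.2 h1]
      rfl
    rw [hlhs]
    simp only [pt, polyMap, Matrix.cons_val_zero, Matrix.cons_val_one,
      eval_homogenize_of_apply_one_eq_zero _ h1]
    split_ifs with hlt hc hc
    · rfl
    · simp [Polynomial.coeff_eq_zero_of_natDegree_lt (hlt.trans_le hP)] at hc
    · exact absurd (by simpa [degree, max_eq_right (not_lt.1 hlt), h0] using hc) A.denom_ne_zero
    · rw [mul_div_mul_right _ _ (pow_ne_zero _ h0), degree, max_eq_right (not_lt.1 hlt),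
        Polynomial.coeff_natDegree]
  · have hlhs : toMap A (pt v) = if A.denom.eval (v 0 / v 1) = 0 then ∞ else
        ((A.num.eval (v 0 / v 1) / A.denom.eval (v 0 / v 1) : ℂ) : Sphere) := by
      rw [pt, if_neg h1]
      rfl
    rw [hlhs]
    simp [pt, polyMap, Polynomial.eval_homogenize hP v h1, Polynomial.eval_homogenize hQ v h1, h1,
      mul_div_mul_right]

lemma isRational_toMap (A : RatFunc ℂ) : IsRational (toMap A) (degree A) := by
  have hP : A.num.natDegree ≤ degree A := le_max_left _ _
  have hQ : A.denom.natDegree ≤ degree A := le_max_right _ _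
  refine ⟨_, by simp [Fin.forall_fin_two], fun v hv => ⟨fun h => ?_, toMap_pt A hv⟩⟩
  simp only [funext_iff, Fin.forall_fin_two, polyMap, Matrix.cons_val_zero, Matrix.cons_val_one,
    Pi.zero_apply] at h
  by_cases h1 : v 1 = 0
  · have h0 : v 0 ≠ 0 := (ne_zero_iff_apply.1 hv).resolve_right (not_not.2 h1)
    simp only [eval_homogenize_of_apply_one_eq_zero _ h1, mul_eq_zero, pow_ne_zero _ h0,
      or_false] at h
    rcases hQ.eq_or_lt with hd | hd
    · rw [← hd, Polynomial.coeff_natDegree, Polynomial.leadingCoeff_eq_zero] at h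
      exact A.denom_ne_zero h.2
    · have hn : A.num.natDegree = degree A := by
        simp only [degree] at hd ⊢
        omega
      rw [← hn, Polynomial.coeff_natDegree, Polynomial.leadingCoeff_eq_zero] at h
      simp [← hn, h.1] at hd
  · simp only [Polynomial.eval_homogenize hP v h1, Polynomial.eval_homogenize hQ v h1, mul_eq_zero,
      pow_ne_zero _ h1, or_false] at h
    obtain ⟨r, s, hrs⟩ := A.isCoprime_num_denom
    simpa [h.1, h.2] using congrArg (Polynomial.eval (v 0 / v 1)) hrs

lemma toMap_X_pow_pt (n : ℕ) {v : Fin 2 → ℂ} (hv : v ≠ 0) :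
    toMap (RatFunc.X ^ n) (pt v) = pt ![v 0 ^ n, v 1 ^ n] := by
  have hX : (RatFunc.X ^ n : RatFunc ℂ) = algebraMap _ _ (Polynomial.X ^ n : Polynomial ℂ) := by
    rw [map_pow, RatFunc.algebraMap_X]
  have hnum : (RatFunc.X ^ n : RatFunc ℂ).num = Polynomial.X ^ n := by
    rw [hX, RatFunc.num_algebraMap]
  have hden : (RatFunc.X ^ n : RatFunc ℂ).denom = 1 := by rw [hX, RatFunc.denom_algebraMap]
  have hdeg : degree (RatFunc.X ^ n) = n := by simp [degree, hnum, hden]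
  rw [toMap_pt _ hv, hdeg, hnum, hden, Polynomial.homogenize_X_pow le_rfl,
    Polynomial.homogenize_one]
  congr 1
  ext i
  fin_cases i <;> simp [polyMap]

lemma toMap_X_pow_inv_pt (n : ℕ) {v : Fin 2 → ℂ} (hv : v ≠ 0) :
    toMap (RatFunc.X ^ n)⁻¹ (pt v) = pt ![v 1 ^ n, v 0 ^ n] := by
  have hX : ((RatFunc.X ^ n)⁻¹ : RatFunc ℂ) =
      algebraMap _ _ (1 : Polynomial ℂ) / algebraMap _ _ (Polynomial.X ^ n : Polynomial ℂ) := by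
    rw [map_pow, RatFunc.algebraMap_X, map_one, one_div]
  have hnum : ((RatFunc.X ^ n)⁻¹ : RatFunc ℂ).num = 1 := by
    rw [hX, RatFunc.num_div]
    simp
  have hden : ((RatFunc.X ^ n)⁻¹ : RatFunc ℂ).denom = Polynomial.X ^ n := by
    rw [hX, RatFunc.denom_div _ (pow_ne_zero _ Polynomial.X_ne_zero)]
    simp
  have hdeg : degree ((RatFunc.X ^ n)⁻¹) = n := by simp [degree, hnum, hden]
  rw [toMap_pt _ hv, hdeg, hnum, hden, Polynomial.homogenize_X_pow le_rfl,
    Polynomial.homogenize_one]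
  congr 1
  ext i
  fin_cases i <;> simp [polyMap]

end RatFuncMaps

section Conjugation

variable {G X : Type*} [Group G] [MulAction G X] {f : X → X} {w : X}

/-- The conjugate `β ∘ f ∘ β⁻¹` of a self-map `f` by a group element `β`. -/
def conjMap (β : G) (f : X → X) : X → X := fun z => β • f (β⁻¹ • z)

lemma conjMap_smul (β : G) (f : X → X) (z : X) : conjMap β f (β • z) = β • f z := by
  rw [conjMap, inv_smul_smul]

lemma conjMap_iterate (β : G) (f : X → X) (m : ℕ) : (conjMap β f)^[m] = conjMap β f^[m] := by
  ext z
  obtain ⟨z, rfl⟩ := MulAction.surjective β z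
  rw [conjMap_smul, (Function.Semiconj.iterate_right (fun z => (conjMap_smul β f z).symm) m).eq]

/-- The only preimage of `w` under `f` is `w` itself. -/
def IsTotallyInvariant (f : X → X) (w : X) : Prop := ∀ z, f z = w ↔ z = w

lemma isTotallyInvariant_conjMap_smul (β : G) :
    IsTotallyInvariant (conjMap β f) (β • w) ↔ IsTotallyInvariant f w := by
  rw [IsTotallyInvariant, (MulAction.surjective β).forall]
  simp only [conjMap_smul, smul_left_cancel_iff, IsTotallyInvariant]

lemma forall_conjMap_smul_eq_iff (β τ : G) (m : ℕ) :
    (∀ z, conjMap β f ((β * τ * β⁻¹) • z) = (β * τ * β⁻¹) ^ m • conjMap β f z) ↔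
      ∀ z, f (τ • z) = τ ^ m • f z := by
  rw [(MulAction.surjective β).forall]
  simp only [conj_pow, mul_smul, inv_smul_smul, conjMap_smul, smul_left_cancel_iff]

end Conjugation

section TotallyInvariant

lemma IsTotallyInvariant.eq_of_map_eq {X : Type*} {f : X → X} (hf : Function.Surjective f) {m : ℕ}
    (hm : 1 ≤ m) {w a b : X} (hw : IsTotallyInvariant f^[m] w) (ha : f a = w) (hb : f b = w) :
    a = b := by
  obtain ⟨l, rfl⟩ : ∃ l, m = l + 1 := ⟨m - 1, by omega⟩
  obtain ⟨u, rfl⟩ := hf.iterate l a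
  obtain ⟨v, rfl⟩ := hf.iterate l b
  rw [← Function.iterate_succ_apply' f l, hw] at ha hb
  rw [ha, hb]

lemma IsTotallyInvariant.of_map_eq {X : Type*} {f : X → X} (hf : Function.Surjective f) {m : ℕ}
    (hm : 1 ≤ m) {w y : X} (hw : IsTotallyInvariant f^[m] w) (hy : f y = w) :
    IsTotallyInvariant f^[m] y := by
  refine fun z => ⟨fun hz => ?_, ?_⟩
  · have hz' : f^[m] (f z) = w := by
      rw [← Function.iterate_succ_apply, Function.iterate_succ_apply', hz, hy]
    exact hw.eq_of_map_eq hf hm ((hw _).1 hz') hy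
  · rintro rfl
    have hz' : f (f^[m] z) = w := by
      rw [← Function.iterate_succ_apply' f m, Function.iterate_succ_apply, hy, (hw w).2 rfl]
    exact hw.eq_of_map_eq hf hm hz' hy

variable {f : Sphere → Sphere} {N : ℕ}

lemma isRational_smul (g : Moebius) : IsRational (fun z : Sphere => g • z) 1 := by
  obtain ⟨M, hM⟩ := exists_gl_smul_eq g
  simpa only [hM] using isRational_gl_smul M

lemma IsRational.conj (hf : IsRational f N) (β : Moebius) : IsRational (conjMap β f) N := by
  have h := (isRational_smul β).comp (hf.comp (isRational_smul β⁻¹))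
  rw [one_mul, mul_one] at h
  exact h

lemma IsRational.eq_or_eq_of_isTotallyInvariant (hf : IsRational f N) (hN : 2 ≤ N)
    {z₀ z₁ w : Sphere} (hne : z₀ ≠ z₁) (h0 : IsTotallyInvariant f z₀)
    (h1 : IsTotallyInvariant f z₁) (hw : IsTotallyInvariant f w) : w = z₀ ∨ w = z₁ := by
  obtain ⟨β, hβ0, hβ1⟩ := exists_smul_eq_zero_infty hne
  replace h0 := hβ0 ▸ (isTotallyInvariant_conjMap_smul β).2 h0
  replace h1 := hβ1 ▸ (isTotallyInvariant_conjMap_smul β).2 h1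
  replace hw := (isTotallyInvariant_conjMap_smul β).2 hw
  obtain ⟨c, -, hc⟩ := (hf.conj β).eq_pow (fun z => (h0 z).1) fun z => (h1 z).1
  by_contra! h
  obtain ⟨x, hx⟩ : ∃ x : ℂ, (x : Sphere) = β • w :=
    OnePoint.ne_infty_iff_exists.1 (hβ1 ▸ (MulAction.injective β).ne h.2)
  rw [← hx] at hw
  have hx0 : x ≠ 0 := by
    rintro rfl
    exact h.1 (smul_left_cancel β (hx.symm.trans hβ0.symm))
  -- Multiplying `x` by an `N`-th root of unity gives further preimages of `x`.
  have hω := Complex.isPrimitiveRoot_exp N (by omega)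
  have hωx : pt ![Complex.exp (2 * Real.pi * Complex.I / N) * x, 1] = (x : Sphere) := by
    rw [← hw, hc _ (by simp)]
    simpa [mul_pow, hω.pow_eq_one, ← pt_coe, hc] using (hw x).2 rfl
  rw [pt_coe, OnePoint.coe_eq_coe, mul_eq_right₀ hx0] at hωx
  exact hω.ne_one hN hωx

lemma IsRational.fixes_or_swaps_of_iterate (hf : IsRational f N) (hN : 2 ≤ N) {m : ℕ} (hm : 1 ≤ m)
    {z₀ z₁ : Sphere} (hne : z₀ ≠ z₁) (h0 : IsTotallyInvariant f^[m] z₀)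
    (h1 : IsTotallyInvariant f^[m] z₁) :
    ((∀ z, f z = z₀ → z = z₀) ∧ ∀ z, f z = z₁ → z = z₁) ∨
      ((∀ z, f z = z₀ → z = z₁) ∧ ∀ z, f z = z₁ → z = z₀) := by
  have hsurj := hf.surjective (by omega)
  have hNm : 2 ≤ N ^ m := hN.trans (Nat.le_self_pow (by omega) N)
  have hmem {w y : Sphere} (hw : IsTotallyInvariant f^[m] w) (hy : f y = w) : y = z₀ ∨ y = z₁ :=
    (hf.iterate m).eq_or_eq_of_isTotallyInvariant hNm hne h0 h1 (hw.of_map_eq hsurj hm hy)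
  obtain ⟨y₀, hy₀⟩ := hsurj z₀
  obtain ⟨y₁, hy₁⟩ := hsurj z₁
  have hy : y₀ ≠ y₁ := by
    rintro rfl
    exact hne (hy₀.symm.trans hy₁)
  have hu₀ (z : Sphere) (hz : f z = z₀) : z = y₀ := h0.eq_of_map_eq hsurj hm hz hy₀
  have hu₁ (z : Sphere) (hz : f z = z₁) : z = y₁ := h1.eq_of_map_eq hsurj hm hz hy₁
  rcases hmem h0 hy₀ with rfl | rfl <;> rcases hmem h1 hy₁ with rfl | rfl
  exacts [absurd rfl hy, Or.inl ⟨hu₀, hu₁⟩, Or.inr ⟨hu₀, hu₁⟩, absurd rfl hy]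

lemma exists_smul_pt_eq {t : ℂ} (ht : t ≠ 0) :
    ∃ γ : Moebius, ∀ v : Fin 2 → ℂ, v ≠ 0 → γ • pt v = pt ![t * v 0, v 1] := by
  let M : GL (Fin 2) ℂ := Matrix.GeneralLinearGroup.mkOfDetNeZero !![t, 0; 0, 1] (by simpa)
  refine ⟨⟨_, M, rfl⟩, fun v hv => (smul_pt M hv).trans ?_⟩
  congr 1
  simp [M, Matrix.GeneralLinearGroup.mkOfDetNeZero]

lemma exists_smul_eq_toMap_X_pow {c : ℂ} (hc : c ≠ 0) (hN : 2 ≤ N) :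
    ∃ γ : Moebius, ∀ v : Fin 2 → ℂ, v ≠ 0 →
      γ • pt ![c * v 0 ^ N, v 1 ^ N] = toMap (RatFunc.X ^ N) (γ • pt v) := by
  obtain ⟨t, rfl⟩ := IsAlgClosed.exists_pow_nat_eq c (n := N - 1) (by omega)
  have ht : t ≠ 0 := (pow_ne_zero_iff (by omega)).1 hc
  obtain ⟨γ, hγ⟩ := exists_smul_pt_eq ht
  refine ⟨γ, fun v hv => ?_⟩
  rw [ne_zero_iff_apply] at hv
  rw [hγ v (ne_zero_iff_apply.2 hv),
    hγ _ (ne_zero_iff_apply.2 (hv.imp (fun h => mul_ne_zero hc (pow_ne_zero N h)) (pow_ne_zero N))),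
    toMap_X_pow_pt N (v := ![t * v 0, v 1]) (ne_zero_iff_apply.2 (hv.imp_left (mul_ne_zero ht)))]
  simp only [Matrix.cons_val_zero, Matrix.cons_val_one, ← mul_assoc,
    mul_pow_sub_one (by omega : N ≠ 0), mul_pow]

lemma exists_smul_eq_toMap_X_pow_inv {c : ℂ} (hc : c ≠ 0) :
    ∃ γ : Moebius, ∀ v : Fin 2 → ℂ, v ≠ 0 →
      γ • pt ![c * v 1 ^ N, v 0 ^ N] = toMap (RatFunc.X ^ N)⁻¹ (γ • pt v) := by
  obtain ⟨t, ht⟩ := IsAlgClosed.exists_pow_nat_eq c⁻¹ (n := N + 1) (by omega)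
  have ht0 : t ≠ 0 := (pow_ne_zero_iff (by omega)).1 (ht ▸ inv_ne_zero hc)
  obtain ⟨γ, hγ⟩ := exists_smul_pt_eq ht0
  refine ⟨γ, fun v hv => ?_⟩
  rw [ne_zero_iff_apply] at hv
  rw [hγ v (ne_zero_iff_apply.2 hv),
    hγ _ (ne_zero_iff_apply.2
      (hv.symm.imp (fun h => mul_ne_zero hc (pow_ne_zero N h)) (pow_ne_zero N))),
    toMap_X_pow_inv_pt N (v := ![t * v 0, v 1])
      (ne_zero_iff_apply.2 (hv.imp_left (mul_ne_zero ht0))),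
    ← pt_smul (pow_ne_zero N ht0)]
  have htc : t ^ N * (t * c) = 1 := by rw [← mul_assoc, ← pow_succ, ht, inv_mul_cancel₀ hc]
  congr 1
  ext i
  fin_cases i
  · simp only [Pi.smul_apply, Matrix.cons_val_zero, Matrix.cons_val_one, smul_eq_mul, Fin.zero_eta]
    linear_combination v 1 ^ N * htc
  · simp [mul_pow]

lemma isConjugateToPower_of_isTotallyInvariant_iterate {A : RatFunc ℂ} (hdeg : 2 ≤ degree A)
    {m : ℕ} (hm : 1 ≤ m) {z₀ z₁ : Sphere} (hne : z₀ ≠ z₁)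
    (h0 : IsTotallyInvariant (toMap A)^[m] z₀) (h1 : IsTotallyInvariant (toMap A)^[m] z₁) :
    IsConjugateToPower A := by
  obtain ⟨β, hβ0, hβ1⟩ := exists_smul_eq_zero_infty hne
  have hf := (isRational_toMap A).conj β
  have hconj {γ : Moebius} {v : Fin 2 → ℂ} {z : Sphere} (hz : pt v = β • z) :
      (γ * β) • toMap A z = γ • conjMap β (toMap A) (pt v) := by rw [hz, conjMap_smul, mul_smul]
  rcases hf.fixes_or_swaps_of_iterate hdeg hm (hβ0 ▸ hβ1 ▸ (MulAction.injective β).ne hne)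
    (by rwa [conjMap_iterate, ← hβ0, isTotallyInvariant_conjMap_smul])
    (by rwa [conjMap_iterate, ← hβ1, isTotallyInvariant_conjMap_smul])
    with ⟨e0, e1⟩ | ⟨e0, e1⟩
  · obtain ⟨c, hc, h⟩ := hf.eq_pow e0 e1
    obtain ⟨γ, hγ⟩ := exists_smul_eq_toMap_X_pow hc hdeg
    refine ⟨γ * β, Or.inl fun z => ?_⟩
    obtain ⟨v, hv, hz⟩ := exists_pt_eq (β • z)
    rw [hconj hz, h v hv, hγ v hv, hz, mul_smul]
  · obtain ⟨c, hc, h⟩ := hf.eq_inv_pow e0 e1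
    obtain ⟨γ, hγ⟩ := exists_smul_eq_toMap_X_pow_inv (N := degree A) hc
    refine ⟨γ * β, Or.inr fun z => ?_⟩
    obtain ⟨v, hv, hz⟩ := exists_pt_eq (β • z)
    rw [hconj hz, h v hv, hγ v hv, hz, mul_smul]

end TotallyInvariant

section FiniteSymmetryGroups

variable {f : Sphere → Sphere} {N : ℕ}

lemma IsRational.finite_symSigma (hf : IsRational f N) (hN : N ≠ 0) :
    (symSigma f : Set Moebius).Finite := by
  have hfin (p : Sphere) : ((· • p) '' (symSigma f : Set Moebius)).Finite := by
    refine (hf.finite_preimage hN (Set.finite_singleton (f p))).subset ?_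
    rintro _ ⟨τ, hτ, rfl⟩
    exact hτ p
  exact finite_of_finite_image_of_three (p := ((0 : ℂ) : Sphere)) (q := ((1 : ℂ) : Sphere))
    (r := ∞) (by simp) (OnePoint.coe_ne_infty _) (OnePoint.coe_ne_infty _)
    (hfin _) (hfin _) (hfin _)

lemma IsRational.exists_fixed_ne (hf : IsRational f N) (hN : 2 ≤ N) {z₀ : Sphere}
    (h : IsTotallyInvariant f z₀) : ∃ w, w ≠ z₀ ∧ f w = w := by
  obtain ⟨β, hβ⟩ := exists_smul_eq_infty z₀
  have hti : IsTotallyInvariant (conjMap β f) ∞ :=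
    hβ ▸ (isTotallyInvariant_conjMap_smul β).2 h
  obtain ⟨w, hw, hfw⟩ := (hf.conj β).exists_fixed_ne_infty hN fun z => (hti z).1
  obtain ⟨w, rfl⟩ : ∃ y, β • y = w := MulAction.surjective β w
  rw [conjMap_smul] at hfw
  exact ⟨w, fun h => hw (by rw [h, hβ]), smul_left_cancel β hfw⟩

lemma IsRational.exists_three_preperiodic (hf : IsRational f N) (hN : 2 ≤ N) {z₀ : Sphere}
    (hz₀ : f z₀ = z₀)
    (h : ∀ w, w ≠ z₀ → ¬ (IsTotallyInvariant f z₀ ∧ IsTotallyInvariant f w)) :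
    ∃ p q r : Sphere, p ≠ q ∧ p ≠ r ∧ q ≠ r ∧
      f (f (f p)) = f (f p) ∧ f (f (f q)) = f (f q) ∧ f (f (f r)) = f (f r) := by
  have hti {y : Sphere} (hy : f y = y) (hn : ∀ w, w ≠ y → f w ≠ y) : IsTotallyInvariant f y :=
    fun z => ⟨fun hz => by_contra fun hc => hn z hc hz, fun hz => by rw [hz, hy]⟩
  by_cases h1 : ∃ w, w ≠ z₀ ∧ f w = z₀
  · obtain ⟨w, hw, hfw⟩ := h1
    obtain ⟨v, hv⟩ := hf.surjective (by omega) w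
    refine ⟨z₀, w, v, hw.symm, ?_, ?_, by simp only [hz₀], by simp only [hfw, hz₀],
      by simp only [hv, hfw, hz₀]⟩
    · rintro rfl; exact hw (hv.symm.trans hz₀)
    · rintro rfl; exact hw (hv.symm.trans hfw)
  · push Not at h1
    have h0 := hti hz₀ h1
    obtain ⟨w, hw, hfw⟩ := hf.exists_fixed_ne hN h0
    by_cases h2 : ∃ v, v ≠ w ∧ f v = w
    · obtain ⟨v, hv, hfv⟩ := h2
      refine ⟨z₀, w, v, hw.symm, ?_, hv.symm, by simp only [hz₀], by simp only [hfw],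
        by simp only [hfv, hfw]⟩
      rintro rfl; exact hw (hfv.symm.trans hz₀)
    · push Not at h2
      exact absurd ⟨h0, hti hfw h2⟩ (h w hw)

lemma IsRational.finite_symAut (hf : IsRational f N) (hN : 2 ≤ N) {z₀ : Sphere}
    (hz₀ : f z₀ = z₀)
    (h : ∀ w, w ≠ z₀ → ¬ (IsTotallyInvariant f z₀ ∧ IsTotallyInvariant f w)) :
    (symAut f : Set Moebius).Finite := by
  have hN0 : N ≠ 0 := by omega
  have hfin {p : Sphere} (hp : f (f (f p)) = f (f p)) :
      ((· • p) '' (symAut f : Set Moebius)).Finite := by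
    refine (hf.finite_preimage hN0 (hf.finite_preimage hN0 (hf.finite_setOf_fixed hN))).subset ?_
    rintro _ ⟨τ, hτ, rfl⟩
    have hτ : ∀ z, f (τ • z) = τ • f z := hτ
    simp only [Set.mem_preimage, Set.mem_ofPred_eq, hτ, hp]
  obtain ⟨p, q, r, hpq, hpr, hqr, hp, hq, hr⟩ := hf.exists_three_preperiodic hN hz₀ h
  exact finite_of_finite_image_of_three hpq hpr hqr (hfin hp) (hfin hq) (hfin hr)

end FiniteSymmetryGroups

section LeadingTerms

open Filter Topology Asymptotics

variable {𝕜 : Type*} [NontriviallyNormedField 𝕜] {u v x y g : 𝕜 → 𝕜} {s i S : ℕ} {U V c : 𝕜}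

/-- `u z = U z ^ s + o(z ^ s)` as `z → 0`; the coefficient `U` may vanish. -/
def HasLeadingTerm (u : 𝕜 → 𝕜) (s : ℕ) (U : 𝕜) : Prop :=
  Tendsto (fun z => u z / z ^ s) (𝓝[≠] 0) (𝓝 U)

lemma eventually_pow_ne_zero (s : ℕ) : ∀ᶠ z : 𝕜 in 𝓝[≠] 0, z ^ s ≠ 0 := by
  filter_upwards [self_mem_nhdsWithin] with z hz using pow_ne_zero s hz

lemma hasLeadingTerm_const (a : 𝕜) : HasLeadingTerm (fun _ => a) 0 a := by
  simp [HasLeadingTerm]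

lemma hasLeadingTerm_id : HasLeadingTerm (fun z : 𝕜 => z) 1 1 := by
  refine tendsto_const_nhds.congr' ?_
  filter_upwards [eventually_pow_ne_zero 1] with z hz
  rw [pow_one] at hz ⊢
  exact (div_self hz).symm

namespace HasLeadingTerm

lemma unique (h : HasLeadingTerm u s U) (h' : HasLeadingTerm u s V) : U = V :=
  tendsto_nhds_unique h h'

lemma congr (h : HasLeadingTerm u s U) (huv : ∀ᶠ z in 𝓝[≠] 0, u z = v z) :
    HasLeadingTerm v s U :=
  Tendsto.congr' (huv.mono fun z hz => by rw [hz]) h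

lemma add (h : HasLeadingTerm u s U) (h' : HasLeadingTerm v s V) :
    HasLeadingTerm (fun z => u z + v z) s (U + V) :=
  (Tendsto.add h h').congr fun _ => (add_div _ _ _).symm

lemma sub (h : HasLeadingTerm u s U) (h' : HasLeadingTerm v s V) :
    HasLeadingTerm (fun z => u z - v z) s (U - V) :=
  (Tendsto.sub h h').congr fun _ => (sub_div _ _ _).symm

lemma mul (h : HasLeadingTerm u s U) (h' : HasLeadingTerm v i V) :
    HasLeadingTerm (fun z => u z * v z) (s + i) (U * V) :=
  (Tendsto.mul h h').congr fun z => by rw [pow_add, mul_div_mul_comm]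

lemma const_mul (h : HasLeadingTerm u s U) (a : 𝕜) :
    HasLeadingTerm (fun z => a * u z) s (a * U) := by
  simpa only [zero_add] using (hasLeadingTerm_const a).mul h

lemma isBigO (h : HasLeadingTerm u s U) : u =O[𝓝[≠] 0] fun z => z ^ s :=
  isBigO_of_div_tendsto_nhds ((eventually_pow_ne_zero s).mono fun _ hz h0 => absurd h0 hz) _ h

lemma of_isBigO (h : u =O[𝓝[≠] 0] fun z => z ^ i) (hs : s < i) : HasLeadingTerm u s 0 :=
  (h.trans_isLittleO ((isLittleO_pow_pow hs).mono nhdsWithin_le_nhds)).tendsto_div_nhds_zero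

lemma of_lt (h : HasLeadingTerm u i U) (hs : s < i) : HasLeadingTerm u s 0 :=
  of_isBigO h.isBigO hs

lemma order_lt (h : HasLeadingTerm u s 0) (h' : HasLeadingTerm u i U) (hU : U ≠ 0) : s < i := by
  by_contra! hle
  rcases hle.eq_or_lt with rfl | hlt
  exacts [hU (h'.unique h), hU (h'.unique (h.of_lt hlt))]

lemma tendsto_zero (h : HasLeadingTerm u s U) (hs : 1 ≤ s) : Tendsto u (𝓝[≠] 0) (𝓝 0) := by
  simpa only [HasLeadingTerm, pow_zero, div_one] using h.of_lt (s := 0) hs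

lemma tendsto_punctured (h : HasLeadingTerm u s U) (hs : 1 ≤ s) (hU : U ≠ 0) :
    Tendsto u (𝓝[≠] 0) (𝓝[≠] 0) := by
  refine tendsto_nhdsWithin_iff.2 ⟨h.tendsto_zero hs, ?_⟩
  filter_upwards [Tendsto.eventually_ne h hU] with z hz
  exact (div_ne_zero_iff.1 hz).1

lemma comp (hg : HasLeadingTerm g S c) (hu : HasLeadingTerm u s U) (hs : 1 ≤ s) (hU : U ≠ 0) :
    HasLeadingTerm (fun z => g (u z)) (s * S) (c * U ^ S) := by
  have hu0 := hu.tendsto_punctured hs hU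
  refine ((Tendsto.comp hg hu0).mul (Tendsto.pow hu S)).congr' ?_
  filter_upwards [hu0.eventually (eventually_pow_ne_zero S)] with z hz
  rw [Function.comp_apply, div_pow, ← pow_mul, div_mul_div_cancel₀ hz]

lemma comp_const_mul (hg : HasLeadingTerm g S c) {ε : 𝕜} (hε : ε ≠ 0) :
    HasLeadingTerm (fun z => g (ε * z)) S (ε ^ S * c) := by
  have h := hg.comp (by simpa using hasLeadingTerm_id.const_mul ε) le_rfl hε
  rwa [one_mul, mul_comm] at h

lemma eq_pow_of_comp_const_mul (hg : HasLeadingTerm g S c) (hc : c ≠ 0) {ε μ : 𝕜} (hε : ε ≠ 0)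
    (h : ∀ᶠ z in 𝓝 0, g (ε * z) = μ * g z) : μ = ε ^ S := by
  have hμ := (hg.const_mul μ).congr (nhdsWithin_le_nhds (h.mono fun _ => Eq.symm))
  exact mul_right_cancel₀ hc (hμ.unique (hg.comp_const_mul hε))

lemma iterate (hg : HasLeadingTerm g S c) (hS : 1 ≤ S) (hc : c ≠ 0) (r : ℕ) :
    ∃ C, C ≠ 0 ∧ HasLeadingTerm g^[r] (S ^ r) C := by
  induction r with
  | zero => exact ⟨1, one_ne_zero, hasLeadingTerm_id⟩
  | succ r ih =>
    obtain ⟨C, hC, h⟩ := ih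
    refine ⟨C * c ^ S ^ r, mul_ne_zero hC (pow_ne_zero _ hc), ?_⟩
    rw [Function.iterate_succ, pow_succ']
    exact h.comp hg hS hc

lemma iterate_one (hg : HasLeadingTerm g 1 c) (hc : c ≠ 0) (r : ℕ) :
    HasLeadingTerm g^[r] 1 (c ^ r) := by
  induction r with
  | zero =>
    rw [pow_zero]
    exact hasLeadingTerm_id
  | succ r ih =>
    have h := ih.comp hg le_rfl hc
    rwa [one_mul, pow_one, ← pow_succ] at h

lemma of_eq_pow_mul {G : 𝕜 → 𝕜} (hG : ContinuousAt G 0) (h : ∀ᶠ z in 𝓝 0, g z = z ^ S * G z) :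
    HasLeadingTerm g S (G 0) := by
  refine (hG.tendsto.mono_left nhdsWithin_le_nhds).congr' ?_
  filter_upwards [nhdsWithin_le_nhds h, eventually_pow_ne_zero S] with z hz hzS
  rw [hz, mul_div_cancel_left₀ _ hzS]

lemma exists_eq_pow_mul (h : HasLeadingTerm g S c) (hg : AnalyticAt 𝕜 g 0) :
    ∃ G : 𝕜 → 𝕜, AnalyticAt 𝕜 G 0 ∧ G 0 = c ∧ ∀ᶠ z in 𝓝 0, g z = z ^ S * G z := by
  by_cases h0 : ∀ᶠ z in 𝓝 0, g z = 0
  · refine ⟨fun _ => 0, analyticAt_const, ?_, by simpa using h0⟩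
    exact HasLeadingTerm.unique (s := S) (by simp [HasLeadingTerm])
      (h.congr (nhdsWithin_le_nhds h0))
  obtain ⟨n, G, hG, hG0, hgG⟩ := hg.exists_eventuallyEq_pow_smul_nonzero_iff.2 h0
  simp only [sub_zero, smul_eq_mul] at hgG
  have hlead : HasLeadingTerm g n (G 0) := of_eq_pow_mul hG.continuousAt hgG
  have hSn : S ≤ n := by
    by_contra! hlt
    exact hG0 (hlead.unique (h.of_lt hlt))
  refine ⟨fun z => z ^ (n - S) * G z, (analyticAt_id.pow _).mul hG, ?_, ?_⟩
  · rcases hSn.eq_or_lt with rfl | hlt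
    · simpa using hlead.unique h
    · simpa [zero_pow (Nat.sub_pos_of_lt hlt).ne'] using (hlead.of_lt hlt).unique h
  · filter_upwards [hgG] with z hz
    rw [hz, ← mul_assoc, ← pow_add, Nat.add_sub_cancel' hSn]

lemma apply_zero (h : HasLeadingTerm g S c) (hg : AnalyticAt 𝕜 g 0) (hS : 1 ≤ S) : g 0 = 0 := by
  obtain ⟨G, -, -, hG⟩ := h.exists_eq_pow_mul hg
  rw [hG.self_of_nhds, zero_pow (by omega), zero_mul]

lemma tendsto_nhds_zero (h : HasLeadingTerm g S c) (hg : AnalyticAt 𝕜 g 0) (hS : 1 ≤ S) :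
    Tendsto g (𝓝 0) (𝓝 0) := by
  simpa only [h.apply_zero hg hS] using hg.continuousAt.tendsto

lemma pow_sub_pow (hy : HasLeadingTerm y s U) (hxy : HasLeadingTerm (fun z => x z - y z) i V)
    (hx : HasLeadingTerm x s U) (n : ℕ) :
    HasLeadingTerm (fun z => x z ^ (n + 1) - y z ^ (n + 1)) (s * n + i)
      ((n + 1) * U ^ n * V) := by
  have hpow (n : ℕ) : HasLeadingTerm (fun z => x z ^ n) (s * n) (U ^ n) :=
    (Tendsto.pow hx n).congr fun z => by rw [div_pow, pow_mul]
  induction n with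
  | zero => simpa using hxy
  | succ n ih =>
    have h := ((hpow (n + 1)).mul hxy).add
      (by simpa only [add_right_comm, mul_add_one] using ih.mul hy)
    convert h using 1
    · ext z; ring
    · push_cast; ring

lemma apply_sub_apply (hgc : HasLeadingTerm g S c) (hg : AnalyticAt 𝕜 g 0) (hS : 1 ≤ S)
    (hy : HasLeadingTerm y s U) (hxy : HasLeadingTerm (fun z => x z - y z) i V) (hs : 1 ≤ s)
    (hsi : s < i) :
    HasLeadingTerm (fun z => g (x z) - g (y z)) (s * (S - 1) + i) (S * c * U ^ (S - 1) * V) := by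
  obtain ⟨n, rfl⟩ : ∃ n, S = n + 1 := ⟨S - 1, by omega⟩
  obtain ⟨G, hG, rfl, hgG⟩ := hgc.exists_eq_pow_mul hg
  have hx : HasLeadingTerm x s U := by simpa using hy.add (hxy.of_lt hsi)
  -- With `g w = w ^ S * G w`, the variation of the cofactor `G` has the larger order `s * S + i`.
  have hx0 := hx.tendsto_zero hs
  have hy0 := hy.tendsto_zero hs
  have hGx : HasLeadingTerm (fun z => G (x z)) 0 (G 0) := by
    simpa [HasLeadingTerm, Function.comp_def] using hG.continuousAt.tendsto.comp hx0
  have hcofactor : (fun z => G (x z) - G (y z)) =O[𝓝[≠] 0] fun z => z ^ i :=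
    ((hG.hasStrictFDerivAt.isBigO_sub).comp_tendsto (hx0.prodMk_nhds hy0)).trans hxy.isBigO
  have hrest : HasLeadingTerm (fun z => y z ^ (n + 1) * (G (x z) - G (y z))) (s * n + i) 0 := by
    refine of_isBigO (i := s * (n + 1) + i) ?_ (by rw [mul_add]; omega)
    simpa only [pow_add, pow_mul] using (hy.isBigO.pow (n + 1)).mul hcofactor
  have h := ((hy.pow_sub_pow hxy hx n).mul hGx).add hrest
  have hcoeff : ((n + 1 : ℕ) : 𝕜) * G 0 * U ^ n * V = (n + 1) * U ^ n * V * G 0 + 0 := by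
    push_cast
    ring
  rw [Nat.add_sub_cancel, hcoeff]
  refine h.congr ?_
  filter_upwards [hx0.eventually hgG, hy0.eventually hgG] with z hgx hgy
  rw [hgx, hgy]
  ring

end HasLeadingTerm

lemma exists_hasLeadingTerm (hg : AnalyticAt 𝕜 g 0) (h0 : ¬ ∀ᶠ z in 𝓝 0, g z = 0) :
    ∃ S c, c ≠ 0 ∧ HasLeadingTerm g S c := by
  obtain ⟨n, G, hG, hG0, hgG⟩ := hg.exists_eventuallyEq_pow_smul_nonzero_iff.2 h0
  exact ⟨n, G 0, hG0, .of_eq_pow_mul hG.continuousAt (by simpa using hgG)⟩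

end LeadingTerms

section RootsOfGerms

open Filter Topology

variable {𝕜 : Type*} [NontriviallyNormedField 𝕜] {b h γ : 𝕜 → 𝕜} {c δ a : 𝕜} {r i j : ℕ}

lemma analyticAt_iterate (hb : AnalyticAt 𝕜 b 0) (h0 : b 0 = 0) (r : ℕ) :
    AnalyticAt 𝕜 b^[r] 0 := by
  induction r with
  | zero => exact analyticAt_id
  | succ r ih => exact AnalyticAt.comp (by rwa [h0]) hb

lemma eventuallyEq_iterate {X : Type*} [TopologicalSpace X] {x : X} {f g : X → X}
    (hg : Tendsto g (𝓝 x) (𝓝 x)) (hfg : f =ᶠ[𝓝 x] g) (k : ℕ) : f^[k] =ᶠ[𝓝 x] g^[k] := by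
  induction k with
  | zero => exact EventuallyEq.rfl
  | succ k ih =>
    filter_upwards [hfg, hg.eventually ih] with z hz hk
    rw [Function.iterate_succ_apply, Function.iterate_succ_apply, hz, hk]

lemma hasLeadingTerm_iterate_sub_iterate (hb : AnalyticAt 𝕜 b 0) (hbc : HasLeadingTerm b 1 c)
    (hhc : HasLeadingTerm h 1 c) (hc : c ≠ 0) (hD : HasLeadingTerm (fun z => h z - b z) i δ)
    (hi : 1 < i) (r : ℕ) :
    HasLeadingTerm (fun z => h^[r] z - b^[r] z) i
      (δ * ∑ k ∈ Finset.range r, (c ^ i) ^ k * c ^ (r - 1 - k)) := by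
  induction r with
  | zero => simp [HasLeadingTerm]
  | succ r ih =>
    have hmove := hbc.apply_sub_apply hb le_rfl (hbc.iterate_one hc r) ih le_rfl hi
    have hnew := hD.comp (hhc.iterate_one hc r) le_rfl (pow_ne_zero r hc)
    simp only [Nat.sub_self, mul_zero, zero_add, Nat.cast_one, one_mul, pow_zero,
      mul_one] at hmove hnew
    convert hmove.add hnew using 1
    · ext z
      rw [Function.iterate_succ_apply', Function.iterate_succ_apply']
      ring
    · rw [Nat.add_sub_cancel, geom_sum₂_succ_eq, ← pow_mul, ← pow_mul, mul_comm i r]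
      ring

lemma pow_eq_one_of_comp_add_eq (hb : AnalyticAt 𝕜 b 0) (hbc : HasLeadingTerm b 1 c) (hc : c ≠ 0)
    (hγ : HasLeadingTerm γ j a) (ha : a ≠ 0) (hj : 1 < j)
    (hcomm : ∀ᶠ z in 𝓝 0, b (z + γ z) = b z + γ (b z)) : c ^ (j - 1) = 1 := by
  have h1 := hbc.apply_sub_apply hb le_rfl (x := fun z => z + γ z) hasLeadingTerm_id
    (by simpa using hγ) le_rfl hj
  have h2 := hγ.comp hbc le_rfl hc
  simp only [Nat.sub_self, mul_zero, zero_add, Nat.cast_one, one_mul, one_pow, mul_one] at h1 h2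
  have hca : c * a = a * c ^ j := h1.unique (h2.congr (nhdsWithin_le_nhds (hcomm.mono
    fun z hz => by rw [hz, add_sub_cancel_left])))
  obtain ⟨n, rfl⟩ : ∃ n, j = n + 1 := ⟨j - 1, by omega⟩
  refine mul_left_cancel₀ (mul_ne_zero hc ha) ?_
  rw [Nat.add_sub_cancel]
  linear_combination -hca

/-- Comparing the terms of degree `i + j - 1` of `D (z + γ z) - D z = γ (h z) - γ (b z)`,
where `D = h - b`, gives `i δ a = j a c ^ (j - 1) δ`. -/
lemma order_eq_of_comp_add_eq [CharZero 𝕜] (hb : AnalyticAt 𝕜 b 0) (hh : AnalyticAt 𝕜 h 0)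
    (hbc : HasLeadingTerm b 1 c) (hc : c ≠ 0)
    (hD : HasLeadingTerm (fun z => h z - b z) i δ) (hδ : δ ≠ 0) (hi : 1 < i)
    (hγ : HasLeadingTerm γ j a) (hγA : AnalyticAt 𝕜 γ 0) (ha : a ≠ 0) (hj : 1 < j)
    (hcb : ∀ᶠ z in 𝓝 0, b (z + γ z) = b z + γ (b z))
    (hch : ∀ᶠ z in 𝓝 0, h (z + γ z) = h z + γ (h z)) : i = j := by
  have h1 := hD.apply_sub_apply (hh.sub hb) hi.le (x := fun z => z + γ z) hasLeadingTerm_id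
    (by simpa using hγ) le_rfl hj
  have h2 := hγ.apply_sub_apply hγA hj.le hbc hD le_rfl hi
  rw [show 1 * (j - 1) + i = 1 * (i - 1) + j by omega,
    pow_eq_one_of_comp_add_eq hb hbc hc hγ ha hj hcb] at h2
  have h3 := h1.unique (h2.congr (nhdsWithin_le_nhds (by
    filter_upwards [hcb, hch] with z hzb hzh
    rw [hzb, hzh]
    ring)))
  rw [one_pow, mul_one, mul_one, mul_assoc, mul_assoc, mul_comm δ a] at h3
  exact_mod_cast mul_right_cancel₀ (mul_ne_zero ha hδ) h3

lemma exists_add_eq_iterate (hb : AnalyticAt 𝕜 b 0) (hbc : HasLeadingTerm b 1 c) (hc : c ≠ 0)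
    (hid : ¬ ∀ᶠ z in 𝓝 0, b^[r] z = z) (hr : c ^ r = 1) :
    ∃ (γ : 𝕜 → 𝕜) (j : ℕ) (a : 𝕜), a ≠ 0 ∧ 1 < j ∧ AnalyticAt 𝕜 γ 0 ∧ HasLeadingTerm γ j a ∧
      ∀ z, b^[r] z = z + γ z := by
  have hγ : AnalyticAt 𝕜 (fun z => b^[r] z - z) 0 :=
    (analyticAt_iterate hb (hbc.apply_zero hb le_rfl) r).sub analyticAt_id
  obtain ⟨j, a, ha, hja⟩ := exists_hasLeadingTerm hγ fun h => hid (h.mono fun _ => sub_eq_zero.1)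
  have hj := (hbc.iterate_one hc r).sub hasLeadingTerm_id
  rw [hr, sub_self] at hj
  exact ⟨_, j, a, ha, hj.order_lt hja ha, hγ, hja, fun z => (add_sub_cancel _ _).symm⟩

lemma geom_sum₂_eq_zero_of_iterate_eventuallyEq (hb : AnalyticAt 𝕜 b 0)
    (hbc : HasLeadingTerm b 1 c) (hhc : HasLeadingTerm h 1 c) (hc : c ≠ 0)
    (hD : HasLeadingTerm (fun z => h z - b z) i δ) (hδ : δ ≠ 0) (hi : 1 < i)
    (heq : h^[r] =ᶠ[𝓝 0] b^[r]) : ∑ k ∈ Finset.range r, (c ^ i) ^ k * c ^ (r - 1 - k) = 0 := by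
  have h0 : HasLeadingTerm (fun z => h^[r] z - b^[r] z) i 0 :=
    HasLeadingTerm.congr (u := fun _ => 0) (by simp [HasLeadingTerm])
      (nhdsWithin_le_nhds (heq.mono fun z hz => by rw [hz, sub_self]))
  have h := (hasLeadingTerm_iterate_sub_iterate hb hbc hhc hc hD hi r).unique h0
  exact (mul_eq_zero.1 h).resolve_left hδ

/-- Uniqueness of compositional roots with a given multiplier. If `h - b ~ δ z ^ i`, then
`h^[r] = b^[r]` forces `(c ^ i) ^ r = c ^ r`, so `b^[r * (i - 1)] = z + γ z` is tangent to the
identity and commutes with `b` and `h`; this is only possible if `c ^ (i - 1) = 1`, but then the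
differences accumulate: `h^[r] - b^[r] ~ r δ c ^ (r - 1) z ^ i`. -/
theorem eventuallyEq_of_iterate_eventuallyEq [CharZero 𝕜] (hb : AnalyticAt 𝕜 b 0)
    (hh : AnalyticAt 𝕜 h 0) (hbc : HasLeadingTerm b 1 c) (hhc : HasLeadingTerm h 1 c) (hc : c ≠ 0)
    (hr : 1 ≤ r) (hid : ∀ t, 1 ≤ t → ¬ ∀ᶠ z in 𝓝 0, b^[t] z = z)
    (heq : h^[r] =ᶠ[𝓝 0] b^[r]) : h =ᶠ[𝓝 0] b := by
  by_contra hne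
  obtain ⟨i, δ, hδ, hD⟩ := exists_hasLeadingTerm (hh.sub hb)
    fun h0 => hne (h0.mono fun _ => sub_eq_zero.1)
  have hi : 1 < i := (sub_self c ▸ hhc.sub hbc).order_lt hD hδ
  have hsum := geom_sum₂_eq_zero_of_iterate_eventuallyEq hb hbc hhc hc hD hδ hi heq
  have hroot : c ^ (r * (i - 1)) = 1 := by
    have hpow := geom_sum₂_mul (c ^ i) c r
    rw [hsum, zero_mul, eq_comm, sub_eq_zero] at hpow
    refine mul_right_cancel₀ (pow_ne_zero r hc) ?_
    rw [one_mul, pow_mul', ← mul_pow, ← pow_succ, Nat.sub_add_cancel hi.le, hpow]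
  obtain ⟨γ, j, a, ha, hj, hγA, hγ, hbγ⟩ :=
    exists_add_eq_iterate hb hbc hc (hid _ (Nat.mul_pos hr (Nat.sub_pos_of_lt hi))) hroot
  have hh0 := hhc.tendsto_nhds_zero hh le_rfl
  have hbr0 : Tendsto b^[r] (𝓝 0) (𝓝 0) := (hbc.iterate_one hc r).tendsto_nhds_zero
    (analyticAt_iterate hb (hbc.apply_zero hb le_rfl) r) le_rfl
  have hhγ : ∀ᶠ z in 𝓝 0, h^[r * (i - 1)] z = z + γ z := by
    filter_upwards [eventuallyEq_iterate hbr0 heq (i - 1)] with z hz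
    rw [← hbγ, Function.iterate_mul, Function.iterate_mul, hz]
  have hcb : ∀ᶠ z in 𝓝 0, b (z + γ z) = b z + γ (b z) := Eventually.of_forall fun z => by
    rw [← hbγ, ← hbγ, ← Function.iterate_succ_apply' b, Function.iterate_succ_apply]
  have hch : ∀ᶠ z in 𝓝 0, h (z + γ z) = h z + γ (h z) := by
    filter_upwards [hhγ, hh0.eventually hhγ] with z hz hhz
    rw [← hz, ← hhz, ← Function.iterate_succ_apply' h, Function.iterate_succ_apply]
  obtain rfl := order_eq_of_comp_add_eq hb hh hbc hc hD hδ hi hγ hγA ha hj hcb hch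
  have hci : c ^ i = c := by
    rw [← Nat.sub_add_cancel hi.le, pow_succ, pow_eq_one_of_comp_add_eq hb hbc hc hγ ha hj hcb,
      one_mul]
  rw [hci, geom_sum₂_self] at hsum
  exact mul_ne_zero (Nat.cast_ne_zero.2 (by omega)) (pow_ne_zero _ hc) hsum

end RootsOfGerms

section LinearEquivariance

open Filter Topology

variable {𝕜 : Type*} [NontriviallyNormedField 𝕜] {b g : 𝕜 → 𝕜} {s i r m : ℕ} {c ε δ : 𝕜}

/-- The failure of `b (ε z) = ε ^ s * b z`. -/
def scalingDefect (b : 𝕜 → 𝕜) (s : ℕ) (ε : 𝕜) : 𝕜 → 𝕜 := fun z => (ε ^ s)⁻¹ * b (ε * z) - b z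

lemma apply_mul_eq (b : 𝕜 → 𝕜) (s : ℕ) (hε : ε ≠ 0) (z : 𝕜) :
    b (ε * z) = ε ^ s * (b z + scalingDefect b s ε z) := by
  rw [scalingDefect, add_sub_cancel, mul_inv_cancel_left₀ (pow_ne_zero s hε)]

lemma analyticAt_comp_const_mul (hb : AnalyticAt 𝕜 b 0) (ε : 𝕜) :
    AnalyticAt 𝕜 (fun z => b (ε * z)) 0 :=
  AnalyticAt.comp (by simpa using hb) (analyticAt_const.mul analyticAt_id)

lemma tendsto_const_mul_zero (ε : 𝕜) : Tendsto (fun z => ε * z) (𝓝 0) (𝓝 0) := by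
  simpa using (continuous_const_mul ε).tendsto 0

lemma hasLeadingTerm_scalingDefect (hbc : HasLeadingTerm b s c) (hε : ε ≠ 0) :
    HasLeadingTerm (scalingDefect b s ε) s 0 := by
  have h := ((hbc.comp_const_mul hε).const_mul (ε ^ s)⁻¹).sub hbc
  rwa [inv_mul_cancel_left₀ (pow_ne_zero s hε), sub_self] at h

lemma hasLeadingTerm_scalingDefect_pow (hD : HasLeadingTerm (scalingDefect b s ε) i δ) (hε : ε ≠ 0)
    (t : ℕ) : ∃ δ', HasLeadingTerm (scalingDefect b s (ε ^ t)) i δ' := by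
  induction t with
  | zero => exact ⟨0, by simp [HasLeadingTerm, scalingDefect]⟩
  | succ t ih =>
    obtain ⟨δ', hδ'⟩ := ih
    refine ⟨_, (((hδ'.comp_const_mul hε).const_mul (ε ^ s)⁻¹).add hD).congr
      (Eventually.of_forall fun z => ?_)⟩
    simp only [scalingDefect]
    rw [← mul_assoc (ε ^ t), ← pow_succ, pow_succ ε t, mul_pow, mul_inv]
    ring

lemma eventually_pow_mul (hg : ∀ᶠ z in 𝓝 0, g (ε * z) = ε ^ s * g z) (t : ℕ) :
    ∀ᶠ z in 𝓝 0, g (ε ^ t * z) = (ε ^ s) ^ t * g z := by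
  induction t with
  | zero => simp
  | succ t ih =>
    filter_upwards [(tendsto_const_mul_zero (ε ^ t)).eventually hg, ih] with z h1 h2
    rw [pow_succ', mul_assoc, h1, h2, pow_succ', mul_assoc]

lemma scalingDefect_comp_eq (hε : ε ≠ 0) {S : ℕ}
    (hcomm : Function.Commute b g) (hg : ∀ᶠ z in 𝓝 0, g (ε * z) = ε ^ S * g z)
    (hbε : Tendsto (fun z => b z + scalingDefect b s ε z) (𝓝 0) (𝓝 0)) :
    ∀ᶠ z in 𝓝 0, scalingDefect b s (ε ^ S) (g z) = g (b z + scalingDefect b s ε z) - g (b z) := by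
  filter_upwards [hg, hbε.eventually (eventually_pow_mul hg s)] with z h1 h2
  rw [scalingDefect, ← h1, hcomm.eq, hcomm.eq, apply_mul_eq b s hε, h2,
    inv_mul_cancel_left₀ (pow_ne_zero s (pow_ne_zero S hε))]

/-- If the defect `D` of `b` has finite order `i > s`, the two sides of
`scalingDefect b s (ε ^ s ^ r) (b^[r] z) = b^[r] (b z + D z) - b^[r] (b z)`
have orders at least `s ^ r * i` and exactly `s * (s ^ r - 1) + i`, which is smaller. -/
lemma equivariant_of_iterate_superattracting [CharZero 𝕜] (hs : 2 ≤ s) (hc : c ≠ 0)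
    (hb : AnalyticAt 𝕜 b 0) (hbc : HasLeadingTerm b s c) (hε : ε ≠ 0) (hr : 1 ≤ r)
    (hg : ∀ᶠ z in 𝓝 0, b^[r] (ε * z) = ε ^ s ^ r * b^[r] z) :
    ∀ᶠ z in 𝓝 0, b (ε * z) = ε ^ s * b z := by
  by_contra hne
  have hDA : AnalyticAt 𝕜 (scalingDefect b s ε) 0 :=
    (analyticAt_const.mul (analyticAt_comp_const_mul hb ε)).sub hb
  obtain ⟨i, δ, hδ, hD⟩ := exists_hasLeadingTerm hDA fun h0 =>
    hne (h0.mono fun z hz => by rw [apply_mul_eq b s hε, hz, add_zero])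
  have hi : s < i := (hasLeadingTerm_scalingDefect hbc hε).order_lt hD hδ
  have hs1 : 1 ≤ s := by omega
  have hS : 2 ≤ s ^ r := hs.trans (Nat.le_self_pow (by omega) s)
  have hS1 : 1 ≤ s ^ r := by omega
  have hbD : Tendsto (fun z => b z + scalingDefect b s ε z) (𝓝 0) (𝓝 0) := by
    simpa using (hbc.tendsto_nhds_zero hb hs1).add (hD.tendsto_nhds_zero hDA (by omega))
  obtain ⟨C, hC, hbr⟩ := hbc.iterate hs1 hc r
  have hbrA := analyticAt_iterate hb (hbc.apply_zero hb hs1) r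
  have hR := hbr.apply_sub_apply hbrA hS1 (x := fun z => b z + scalingDefect b s ε z) hbc
    (by simpa using hD) hs1 hi
  obtain ⟨δ', hδ'⟩ := hasLeadingTerm_scalingDefect_pow hD hε (s ^ r)
  have hL := (hδ'.comp hbr hS1 hC).congr (nhdsWithin_le_nhds
    (scalingDefect_comp_eq hε ((Function.Commute.refl b).iterate_right r) hg hbD))
  have hlt : s * (s ^ r - 1) + i < s ^ r * i := by
    obtain ⟨n, hn⟩ : ∃ n, s ^ r = n + 1 := ⟨s ^ r - 1, by omega⟩
    have : s * n < i * n := Nat.mul_lt_mul_of_pos_right hi (by omega)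
    rw [hn, Nat.add_sub_cancel, add_one_mul, mul_comm n i]
    omega
  refine mul_ne_zero (mul_ne_zero (mul_ne_zero ?_ hC) (pow_ne_zero _ hc)) hδ
    (hR.unique (hL.of_lt hlt))
  exact Nat.cast_ne_zero.2 (by omega)

lemma equivariant_of_iterate_invertible [CharZero 𝕜] (hc : c ≠ 0)
    (hb : AnalyticAt 𝕜 b 0) (hbc : HasLeadingTerm b 1 c)
    (hid : ∀ t, 1 ≤ t → ¬ ∀ᶠ z in 𝓝 0, b^[t] z = z) (hε : ε ≠ 0) (hr : 1 ≤ r)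
    (hg : ∀ᶠ z in 𝓝 0, b^[r] (ε * z) = ε * b^[r] z) :
    ∀ᶠ z in 𝓝 0, b (ε * z) = ε * b z := by
  have hconj (z : 𝕜) : (fun z => ε⁻¹ * b (ε * z))^[r] z = ε⁻¹ * b^[r] (ε * z) := by
    have hsemi : Function.Semiconj (ε * ·) (fun z => ε⁻¹ * b (ε * z)) b :=
      fun z => mul_inv_cancel_left₀ hε _
    rw [← (hsemi.iterate_right r).eq, inv_mul_cancel_left₀ hε]
  have hlead : HasLeadingTerm (fun z => ε⁻¹ * b (ε * z)) 1 c := by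
    have h := (hbc.comp_const_mul hε).const_mul ε⁻¹
    rwa [pow_one, inv_mul_cancel_left₀ hε] at h
  filter_upwards [eventuallyEq_of_iterate_eventuallyEq (h := fun z => ε⁻¹ * b (ε * z)) hb
    (analyticAt_const.mul (analyticAt_comp_const_mul hb ε)) hbc hlead hc hr hid
    (hg.mono fun z hz => by rw [hconj, hz, inv_mul_cancel_left₀ hε])] with z hz
  rw [← hz, mul_inv_cancel_left₀ hε]

theorem equivariant_of_iterate [CharZero 𝕜] (hs : 1 ≤ s) (hc : c ≠ 0)
    (hb : AnalyticAt 𝕜 b 0) (hbc : HasLeadingTerm b s c)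
    (hid : ∀ t, 1 ≤ t → ¬ ∀ᶠ z in 𝓝 0, b^[t] z = z) (hε : ε ≠ 0) (hr : 1 ≤ r)
    (hg : ∀ᶠ z in 𝓝 0, b^[r] (ε * z) = ε ^ m * b^[r] z) :
    ∀ᶠ z in 𝓝 0, b (ε * z) = ε ^ s * b z := by
  obtain ⟨C, hC, hbr⟩ := hbc.iterate hs hc r
  rw [hbr.eq_pow_of_comp_const_mul hC hε hg] at hg
  rcases hs.eq_or_lt with rfl | hs2
  · simp only [one_pow, pow_one] at hg ⊢
    exact equivariant_of_iterate_invertible hc hb hbc hid hε hr hg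
  · exact equivariant_of_iterate_superattracting hs2 hc hb hbc hε hr hg

end LinearEquivariance

section FiniteGroups

/-- With `n i` the lengths of the orbits of a group of order `N`, the equality is the orbit count
`∑ i, (1 - n i / N) = 2 - 2 / N` of a finite rotation group. -/
lemma orbitLength_le_two {ι : Type*} [Fintype ι] {n : ι → ℕ} {N : ℕ}
    (hn : ∀ i, 2 * n i = N ∨ 3 * n i ≤ N) {i₀ : ι} (hi₀ : 6 * n i₀ ≤ N)
    (hsum : ∑ i, n i + 2 * N = Fintype.card ι * N + 2) : n i₀ ≤ 2 := by
  classical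
  have hcard : Fintype.card ι < 4 := by
    have hle : 2 * ∑ i, n i ≤ Fintype.card ι * N := by
      rw [Finset.mul_sum]
      exact Finset.sum_le_card_nsmul _ _ _ fun i _ => by have := hn i; omega
    exact lt_of_mul_lt_mul_right (by omega : Fintype.card ι * N < 4 * N) N.zero_le
  rw [← Finset.add_sum_erase _ _ (Finset.mem_univ i₀)] at hsum
  have hrest : (Finset.univ.erase i₀).card + 1 = Fintype.card ι :=
    Finset.card_erase_add_one (Finset.mem_univ i₀)
  obtain h0 | h1 | h2 : (Finset.univ.erase i₀).card = 0 ∨ (Finset.univ.erase i₀).card = 1 ∨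
      (Finset.univ.erase i₀).card = 2 := by omega
  · rw [← hrest, h0, Finset.card_eq_zero.1 h0, Finset.sum_empty] at hsum
    omega
  · obtain ⟨a, ha⟩ := Finset.card_eq_one.1 h1
    rw [← hrest, h1, ha, Finset.sum_singleton] at hsum
    have := hn a
    omega
  · obtain ⟨a, b, hab, hs⟩ := Finset.card_eq_two.1 h2
    rw [← hrest, h2, hs, Finset.sum_pair hab] at hsum
    have := hn a
    have := hn b
    omega

open MulAction

variable {G X : Type*} [Group G] [MulAction G X]

lemma sum_ncard_orbit [Finite X] [Fintype (orbitRel.Quotient G X)] :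
    ∑ ω : orbitRel.Quotient G X, ω.orbit.ncard = Nat.card X := by
  rw [Nat.card_congr (selfEquivSigmaOrbits' G X), Nat.card_sigma]
  rfl

lemma card_add_eq_of_ncard_fixedBy [Finite G] [Finite X] [Fintype (orbitRel.Quotient G X)]
    (hfix : ∀ g : G, g ≠ 1 → (fixedBy X g).ncard = 2) :
    Nat.card X + 2 * Nat.card G =
      Fintype.card (orbitRel.Quotient G X) * Nat.card G + 2 := by
  classical
  have := Fintype.ofFinite G
  have := fun g : G => Fintype.ofFinite (fixedBy X g)
  have hburnside := sum_card_fixedBy_eq_card_orbits_mul_card_group G X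
  simp only [← Nat.card_eq_fintype_card, Nat.card_coe_set_eq] at hburnside ⊢
  rw [← hburnside, ← Finset.add_sum_erase _ _ (Finset.mem_univ (1 : G)), fixedBy_one_eq_univ,
    Set.ncard_univ, Finset.sum_congr rfl fun g hg => hfix g (Finset.ne_of_mem_erase hg),
    Finset.sum_const, smul_eq_mul, Nat.card_eq_fintype_card (α := G),
    ← Finset.card_univ, ← Finset.card_erase_add_one (Finset.mem_univ (1 : G))]
  ring

lemma ncard_orbit_mul_card_stabilizer (x : X) :
    (orbit G x).ncard * Nat.card (stabilizer G x) = Nat.card G := by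
  rw [← index_stabilizer, Subgroup.index_mul_card]

lemma ncard_orbit_le_two [Finite G] [Finite X]
    (hfix : ∀ g : G, g ≠ 1 → (fixedBy X g).ncard = 2)
    (hstab : ∀ x : X, stabilizer G x ≠ ⊥) {x : X} (hx : 6 ≤ Nat.card (stabilizer G x)) :
    (orbit G x).ncard ≤ 2 := by
  have := Fintype.ofFinite (orbitRel.Quotient G X)
  have hlength (ω : orbitRel.Quotient G X) :
      2 * ω.orbit.ncard = Nat.card G ∨ 3 * ω.orbit.ncard ≤ Nat.card G := by
    induction ω using Quotient.inductionOn' with | _ y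
    have hy : 1 < Nat.card (stabilizer G y) := (Subgroup.one_lt_card_iff_ne_bot _).2 (hstab y)
    rw [orbitRel.Quotient.orbit_mk, ← ncard_orbit_mul_card_stabilizer y, mul_comm _ (Nat.card _)]
    rcases (Nat.succ_le_of_lt hy).eq_or_lt with h2 | h3
    · exact .inl (by rw [← h2])
    · exact .inr (Nat.mul_le_mul_right _ h3)
  refine orbitLength_le_two (i₀ := (Quotient.mk'' x : orbitRel.Quotient G X)) hlength ?_ ?_
  · rw [orbitRel.Quotient.orbit_mk, ← ncard_orbit_mul_card_stabilizer x, mul_comm]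
    exact Nat.mul_le_mul_left _ hx
  · rw [sum_ncard_orbit, card_add_eq_of_ncard_fixedBy hfix]

variable (G X) in
/-- The points with a nontrivial stabilizer, as an invariant subset: in a finite group action whose
nontrivial elements have finitely many fixed points it is finite, so orbits can be counted on it. -/
def ramifiedPoints : SubMulAction G X where
  carrier := {x | ∃ g : G, g ≠ 1 ∧ g • x = x}
  smul_mem' := by
    rintro h x ⟨g, hg, hx⟩
    refine ⟨h * g * h⁻¹, by simpa only [ne_eq, conj_eq_one_iff] using hg, ?_⟩
    rw [mul_smul, mul_smul, inv_smul_smul, hx]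

lemma finite_ramifiedPoints [Finite G] (hfix : ∀ g : G, g ≠ 1 → (fixedBy X g).ncard = 2) :
    Finite (ramifiedPoints G X) := by
  have hunion : (ramifiedPoints G X : Set X) = ⋃ g : {g : G // g ≠ 1}, fixedBy X (g : G) := by
    ext x
    simp only [Set.mem_iUnion, Subtype.exists, exists_prop]
    rfl
  refine (hunion ▸ Set.finite_iUnion fun g => ?_ : (ramifiedPoints G X : Set X).Finite).to_subtype
  exact Set.finite_of_ncard_ne_zero (by rw [hfix g g.2]; exact two_ne_zero)

lemma ncard_fixedBy_ramifiedPoints {g : G} (hg : g ≠ 1) :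
    (fixedBy (ramifiedPoints G X) g).ncard = (fixedBy X g).ncard := by
  rw [← Set.ncard_image_of_injective _ Subtype.val_injective]
  congr 1
  ext x
  constructor
  · rintro ⟨y, hy, rfl⟩
    exact congrArg Subtype.val hy
  · exact fun hx => ⟨⟨x, g, hg, hx⟩, Subtype.ext hx, rfl⟩

lemma orbit_subset_fixedBy [Finite G] (hfix : ∀ g : G, g ≠ 1 → (fixedBy X g).ncard = 2) {s : G}
    (hs : 5 < orderOf s) {x : X} (hx : s • x = x) : orbit G x ⊆ fixedBy X s := by
  have := finite_ramifiedPoints hfix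
  have hs1 : s ≠ 1 := by
    rintro rfl
    simp only [orderOf_one] at hs
    omega
  let y : ramifiedPoints G X := ⟨x, s, hs1, hx⟩
  have hy : s • y = y := Subtype.ext hx
  have hcard : 6 ≤ Nat.card (stabilizer G y) := by
    rw [← Nat.card_zpowers] at hs
    exact hs.trans_le (Subgroup.card_le_of_le (by rwa [Subgroup.zpowers_le]))
  have horbit : (orbit G y).ncard ≤ 2 := by
    refine ncard_orbit_le_two (fun g hg => by rw [ncard_fixedBy_ramifiedPoints hg, hfix g hg])
      ?_ hcard
    rintro ⟨z, g, hg, hz⟩ hbot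
    exact hg (Subgroup.mem_bot.1 (hbot ▸ mem_stabilizer_iff.2 (Subtype.ext hz)))
  -- An orbit point `t • y` not fixed by `s` gives three points `y`, `t • y`, `s • t • y`.
  rintro _ ⟨t, rfl⟩
  by_contra hmove
  have hmove' : s • t • y ≠ t • y := fun h => hmove (congrArg Subtype.val h)
  refine horbit.not_gt ((Set.two_lt_ncard_iff (Set.toFinite _)).2 ⟨y, t • y, s • t • y,
    mem_orbit_self y, mem_orbit y t, by rw [← mul_smul]; exact mem_orbit y _,
    fun h => hmove' ?_, fun h => hmove' ?_, hmove'.symm⟩)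
  · rw [← h, hy]
  · rw [← h, ← smul_left_cancel s (hy.trans h)]

end FiniteGroups

lemma smul_eq_or_eq_of_mem {H : Subgroup Moebius} (hH : (H : Set Moebius).Finite) {σ : Moebius}
    (hσH : σ ∈ H) (hσ : 5 < orderOf σ) {z₀ z₁ : Sphere} (hne : z₀ ≠ z₁) (hσ₀ : σ • z₀ = z₀)
    (hσ₁ : σ • z₁ = z₁) {τ : Moebius} (hτ : τ ∈ H) : τ • z₀ = z₀ ∨ τ • z₀ = z₁ := by
  have : Finite H := hH.to_subtype
  have hfix (g : H) (hg : g ≠ 1) : (MulAction.fixedBy Sphere g).ncard = 2 :=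
    ncard_fixedBy (H.subtype.isOfFinOrder (isOfFinOrder_of_finite g)) (by simpa using hg)
  have hσorder : 5 < orderOf (⟨σ, hσH⟩ : H) := by rwa [← Subgroup.orderOf_coe]
  have hστ : σ • τ • z₀ = τ • z₀ :=
    orbit_subset_fixedBy hfix hσorder hσ₀ (MulAction.mem_orbit z₀ (⟨τ, hτ⟩ : H))
  by_contra! hmove
  have hσ1 : σ = 1 := eq_one_of_smul_eq_self_of_three hne hmove.1.symm hmove.2.symm hσ₀ hσ₁ hστ
  rw [hσ1, orderOf_one] at hσ
  omega

section Germs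

open Filter Topology

variable {𝕜 : Type*} [NontriviallyNormedField 𝕜] {b : 𝕜 → 𝕜} {s : ℕ} {c : 𝕜}

lemma exists_hasLeadingTerm_sub (hb : AnalyticAt 𝕜 b 0) (hbc : HasLeadingTerm b s c)
    (h : ¬ ∀ᶠ z in 𝓝 0, b z = c * z ^ s) :
    ∃ i d, s < i ∧ d ≠ 0 ∧ HasLeadingTerm (fun z => b z - c * z ^ s) i d := by
  obtain ⟨i, d, hd, hi⟩ := exists_hasLeadingTerm
    (hb.sub (analyticAt_const.mul (analyticAt_id.pow s)))
    (by simpa only [Pi.sub_apply, Pi.mul_apply, Pi.pow_apply, id_eq, sub_eq_zero] using h)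
  refine ⟨i, d, ?_, hd, hi⟩
  have hpow : HasLeadingTerm (fun z : 𝕜 => z ^ s) s 1 := by
    refine tendsto_const_nhds.congr' ?_
    filter_upwards [eventually_pow_ne_zero s] with z hz using (div_self hz).symm
  have hsub := hbc.sub (hpow.const_mul c)
  rw [mul_one, sub_self] at hsub
  exact hsub.order_lt hi hd

lemma finite_setOf_comp_const_mul_eq (hb : AnalyticAt 𝕜 b 0) (hc : c ≠ 0)
    (hbc : HasLeadingTerm b s c) (h : ¬ ∀ᶠ z in 𝓝 0, b z = c * z ^ s) :
    {ε : 𝕜 | ε ≠ 0 ∧ ∃ m : ℕ, ∀ᶠ z in 𝓝 0, b (ε * z) = ε ^ m * b z}.Finite := by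
  obtain ⟨i, d, hsi, hd, hi⟩ := exists_hasLeadingTerm_sub hb hbc h
  refine (Polynomial.nthRoots (i - s) (1 : 𝕜)).finite_toSet.subset ?_
  rintro ε ⟨hε, m, hm⟩
  have hms : ε ^ m = ε ^ s := hbc.eq_pow_of_comp_const_mul hc hε hm
  have hsi' : ε ^ s = ε ^ i := by
    refine hi.eq_pow_of_comp_const_mul hd hε ?_
    filter_upwards [hm] with z hz
    rw [hz, hms]
    ring
  rw [Set.mem_ofPred_eq, Polynomial.mem_nthRoots (by omega), ← mul_right_inj' (pow_ne_zero s hε),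
    ← pow_add, Nat.add_sub_cancel' hsi.le, mul_one, hsi']

variable {f g : OnePoint 𝕜 → OnePoint 𝕜} {N M : ℕ}

lemma eventually_iterate_eq (hb : Tendsto b (𝓝 0) (𝓝 0))
    (h : ∀ᶠ z : 𝕜 in 𝓝 0, f z = (b z : OnePoint 𝕜)) (r : ℕ) :
    ∀ᶠ z : 𝕜 in 𝓝 0, f^[r] z = (b^[r] z : OnePoint 𝕜) := by
  induction r with
  | zero => exact Eventually.of_forall fun z => rfl
  | succ r ih =>
    filter_upwards [h, hb.eventually ih] with z h1 h2
    rw [Function.iterate_succ_apply, Function.iterate_succ_apply, h1, h2]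

variable [DecidableEq 𝕜]

lemma IsRational.eq_of_eventually (hf : IsRational f N) (hg : IsRational g M)
    (h : ∀ᶠ z : 𝕜 in 𝓝 0, f z = g z) : f = g :=
  hf.eq_of_infinite hg <| ((infinite_of_mem_nhds 0 h).image OnePoint.coe_injective.injOn).mono <|
    Set.image_subset_iff.2 fun _ hz => hz

lemma IsRational.exists_germ (hf : IsRational f N)
    (h0 : f ((0 : 𝕜) : OnePoint 𝕜) = ((0 : 𝕜) : OnePoint 𝕜)) :
    ∃ b : 𝕜 → 𝕜, AnalyticAt 𝕜 b 0 ∧ b 0 = 0 ∧ ∀ᶠ z : 𝕜 in 𝓝 0, f z = (b z : OnePoint 𝕜) := by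
  obtain ⟨F, -, hF⟩ := hf
  have hne (z : 𝕜) : (![z, 1] : Fin 2 → 𝕜) ≠ 0 := ne_zero_iff_apply.2 (.inr one_ne_zero)
  have hval (z : 𝕜) : f z = pt (polyMap F ![z, 1]) := by rw [← pt_coe, (hF _ (hne z)).2]
  have hA (i : Fin 2) : AnalyticAt 𝕜 (fun z => polyMap F ![z, 1] i) 0 := by
    simp only [polyMap, ← MvPolynomial.coe_aeval_eq_eval, RingHom.coe_coe]
    refine AnalyticAt.aeval_mvPolynomial (fun j => ?_) (F i)
    fin_cases j
    exacts [analyticAt_id, analyticAt_const]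
  have hnum : polyMap F ![0, 1] 0 = 0 := by rwa [hval, pt_eq_zero_iff (hF _ (hne 0)).1] at h0
  have hden : polyMap F ![0, 1] 1 ≠ 0 :=
    (ne_zero_iff_apply.1 (hF _ (hne 0)).1).resolve_left (not_not.2 hnum)
  refine ⟨_, (hA 0).div (hA 1) hden, by simp [hnum], ?_⟩
  filter_upwards [(hA 1).continuousAt.eventually_ne hden] with z hz
  rw [hval, pt, if_neg hz]
  rfl

variable [IsAlgClosed 𝕜]

lemma IsRational.exists_germ_hasLeadingTerm (hf : IsRational f N) (hN : N ≠ 0)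
    (h0 : f ((0 : 𝕜) : OnePoint 𝕜) = ((0 : 𝕜) : OnePoint 𝕜)) :
    ∃ (b : 𝕜 → 𝕜) (s : ℕ) (c : 𝕜), 1 ≤ s ∧ c ≠ 0 ∧ AnalyticAt 𝕜 b 0 ∧ HasLeadingTerm b s c ∧
      ∀ᶠ z : 𝕜 in 𝓝 0, f z = (b z : OnePoint 𝕜) := by
  obtain ⟨b, hb, hb0, hfb⟩ := hf.exists_germ h0
  have hnonzero : ¬ ∀ᶠ z in 𝓝 0, b z = 0 := by
    intro hzero
    have hconst : f = fun _ => ((0 : 𝕜) : OnePoint 𝕜) :=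
      hf.eq_of_eventually (isRational_const _) (by
        filter_upwards [hfb, hzero] with z h1 h2
        rw [h1, h2])
    obtain ⟨z, hz⟩ := hf.surjective hN ∞
    exact OnePoint.coe_ne_infty 0 ((congrFun hconst z).symm.trans hz)
  obtain ⟨s, c, hc, hbc⟩ := exists_hasLeadingTerm hb hnonzero
  have hzero : HasLeadingTerm b 0 0 := by
    simpa only [HasLeadingTerm, pow_zero, div_one, hb0] using
      hb.continuousAt.continuousWithinAt.tendsto (s := {0}ᶜ)
  exact ⟨b, s, c, hzero.order_lt hbc hc, hc, hb, hbc, hfb⟩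

lemma IsRational.not_eventually_iterate_eq_self (hf : IsRational f N) (hN : 2 ≤ N)
    (hb : Tendsto b (𝓝 0) (𝓝 0)) (hfb : ∀ᶠ z : 𝕜 in 𝓝 0, f z = (b z : OnePoint 𝕜)) {t : ℕ}
    (ht : 1 ≤ t) : ¬ ∀ᶠ z in 𝓝 0, b^[t] z = z := by
  intro hid
  have hfid : f^[t] = id := (hf.iterate t).eq_of_eventually isRational_id (by
    filter_upwards [hid, eventually_iterate_eq hb hfb t] with z h1 h2
    rw [h2, h1, id])
  have hfinite := (hf.iterate t).finite_setOf_fixed (hN.trans (Nat.le_self_pow (by omega) N))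
  rw [hfid] at hfinite
  exact Set.infinite_univ (by simpa using hfinite)

end Germs

section LocalSymmetries

open Filter Topology

variable {f : Sphere → Sphere} {N : ℕ} {b : ℂ → ℂ} {τ : Moebius} {ε : ℂ}

lemma pow_smul_coe (hτ : ∀ z : ℂ, τ • (z : Sphere) = ((ε * z : ℂ) : Sphere)) (m : ℕ) (z : ℂ) :
    τ ^ m • (z : Sphere) = ((ε ^ m * z : ℂ) : Sphere) := by
  induction m with
  | zero => simp
  | succ m ih => rw [pow_succ', mul_smul, ih, hτ, pow_succ', mul_assoc]

lemma eventually_germ_equivariant (hfb : ∀ᶠ z : ℂ in 𝓝 0, f z = (b z : Sphere))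
    (hτ : ∀ z : ℂ, τ • (z : Sphere) = ((ε * z : ℂ) : Sphere)) {m : ℕ}
    (h : ∀ z, f (τ • z) = τ ^ m • f z) : ∀ᶠ z in 𝓝 0, b (ε * z) = ε ^ m * b z := by
  filter_upwards [hfb, (tendsto_const_mul_zero ε).eventually hfb] with z h1 h2
  rw [← OnePoint.coe_eq_coe, ← h2, ← hτ, h, h1, pow_smul_coe hτ]

lemma IsRational.equivariant_of_germ (hf : IsRational f N)
    (hfb : ∀ᶠ z : ℂ in 𝓝 0, f z = (b z : Sphere))
    (hτ : ∀ z : ℂ, τ • (z : Sphere) = ((ε * z : ℂ) : Sphere)) {m : ℕ}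
    (h : ∀ᶠ z in 𝓝 0, b (ε * z) = ε ^ m * b z) (z : Sphere) : f (τ • z) = τ ^ m • f z := by
  refine congrFun ((hf.comp (isRational_smul τ)).eq_of_eventually
    ((isRational_smul (τ ^ m)).comp hf) ?_) z
  filter_upwards [hfb, (tendsto_const_mul_zero ε).eventually hfb, h] with z h1 h2 h3
  simp only [Function.comp_apply, hτ, h1, h2, h3, pow_smul_coe hτ]

lemma IsRational.equivariant_of_iterate_zero_infty (hf : IsRational f N) (hN : 2 ≤ N)
    (h0 : f ((0 : ℂ) : Sphere) = ((0 : ℂ) : Sphere))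
    (hτ0 : τ • ((0 : ℂ) : Sphere) = ((0 : ℂ) : Sphere)) (hτ1 : τ • (∞ : Sphere) = ∞)
    {r m : ℕ} (hr : 1 ≤ r) (h : ∀ z, f^[r] (τ • z) = τ ^ m • f^[r] z) :
    ∃ s, 1 ≤ s ∧ ∀ z, f (τ • z) = τ ^ s • f z := by
  obtain ⟨ε, hε, hτ⟩ := exists_homothety_of_smul_zero_infty hτ0 hτ1
  obtain ⟨b, s, c, hs, hc, hb, hbc, hfb⟩ := hf.exists_germ_hasLeadingTerm (by omega) h0
  have hb0 : Tendsto b (𝓝 0) (𝓝 0) := hbc.tendsto_nhds_zero hb hs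
  have hgerm : ∀ᶠ z in 𝓝 0, b (ε * z) = ε ^ s * b z :=
    equivariant_of_iterate hs hc hb hbc
      (fun t ht => hf.not_eventually_iterate_eq_self hN hb0 hfb ht) hε hr
      (eventually_germ_equivariant (eventually_iterate_eq hb0 hfb r) hτ h)
  exact ⟨s, hs, hf.equivariant_of_germ hfb hτ hgerm⟩

lemma IsRational.equivariant_of_iterate (hf : IsRational f N) (hN : 2 ≤ N) {z₀ z₁ : Sphere}
    (hne : z₀ ≠ z₁) (h0 : f z₀ = z₀) (hτ0 : τ • z₀ = z₀) (hτ1 : τ • z₁ = z₁) {r m : ℕ}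
    (hr : 1 ≤ r) (h : ∀ z, f^[r] (τ • z) = τ ^ m • f^[r] z) :
    ∃ s, 1 ≤ s ∧ ∀ z, f (τ • z) = τ ^ s • f z := by
  obtain ⟨β, hβ0, hβ1⟩ := exists_smul_eq_zero_infty hne
  have hconj {z : Sphere} (hz : τ • z = z) : (β * τ * β⁻¹) • β • z = β • z := by
    rw [mul_smul, mul_smul, inv_smul_smul, hz]
  obtain ⟨s, hs, H⟩ := (hf.conj β).equivariant_of_iterate_zero_infty (τ := β * τ * β⁻¹) hN
    (by rw [← hβ0, conjMap_smul, h0]) (hβ0 ▸ hconj hτ0) (hβ1 ▸ hconj hτ1) hr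
    (by rw [conjMap_iterate]; exact (forall_conjMap_smul_eq_iff β τ m).2 h)
  exact ⟨s, hs, (forall_conjMap_smul_eq_iff β τ s).1 H⟩

lemma mem_localG_iff {z₀ z₁ : Sphere} :
    τ ∈ localG f z₀ z₁ ↔
      τ • z₀ = z₀ ∧ τ • z₁ = z₁ ∧ ∃ m : ℕ, 1 ≤ m ∧ ∀ z, f (τ • z) = τ ^ m • f z :=
  ⟨fun h => h.2, fun h => ⟨h.2.2.imp' _ fun _ hm => hm.2, h⟩⟩

lemma conj_mem_localG_iff (β : Moebius) {z₀ z₁ : Sphere} :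
    β * τ * β⁻¹ ∈ localG (conjMap β f) (β • z₀) (β • z₁) ↔ τ ∈ localG f z₀ z₁ := by
  simp only [mem_localG_iff, forall_conjMap_smul_eq_iff]
  simp only [mul_smul, inv_smul_smul, smul_left_cancel_iff]

lemma IsRational.isTotallyInvariant_of_germ_eq_monomial (hf : IsRational f N) {s : ℕ} {c : ℂ}
    (hs : s ≠ 0) (hc : c ≠ 0) (h : ∀ᶠ z : ℂ in 𝓝 0, f z = ((c * z ^ s : ℂ) : Sphere)) :
    IsTotallyInvariant f ((0 : ℂ) : Sphere) ∧ IsTotallyInvariant f ∞ := by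
  obtain ⟨γ, hγ⟩ := exists_smul_pt_eq hc
  have hne {a : ℂ} (ha : a ≠ 0) {v : Fin 2 → ℂ} (hv : v ≠ 0) :
      (![a * v 0 ^ s, v 1 ^ s] : Fin 2 → ℂ) ≠ 0 := by
    rw [ne_zero_iff_apply] at hv ⊢
    exact hv.imp (fun h => mul_ne_zero ha (pow_ne_zero s h)) (pow_ne_zero s)
  have hmonomial {v : Fin 2 → ℂ} (hv : v ≠ 0) :
      γ • toMap (RatFunc.X ^ s) (pt v) = pt ![c * v 0 ^ s, v 1 ^ s] := by
    rw [toMap_X_pow_pt s hv, hγ _ (by simpa using hne one_ne_zero hv)]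
    rfl
  have hfγ : f = (γ • ·) ∘ toMap (RatFunc.X ^ s) :=
    hf.eq_of_eventually ((isRational_smul γ).comp (isRational_toMap _)) (by
      filter_upwards [h] with z hz
      rw [hz, Function.comp_apply, ← pt_coe z,
        hmonomial (ne_zero_iff_apply.2 (.inr one_ne_zero)), ← pt_coe]
      simp)
  have hfv {v : Fin 2 → ℂ} (hv : v ≠ 0) : f (pt v) = pt ![c * v 0 ^ s, v 1 ^ s] := by
    rw [hfγ, Function.comp_apply, hmonomial hv]
  constructor <;> intro z <;> obtain ⟨v, hv, rfl⟩ := exists_pt_eq z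
  · simp [hfv hv, pt_eq_zero_iff (hne hc hv), pt_eq_zero_iff hv, hc, hs]
  · simp [hfv hv, pt_eq_infty_iff, hs]

lemma IsRational.finite_localG_zero_infty (hf : IsRational f N) (hN : N ≠ 0)
    (h0 : f ((0 : ℂ) : Sphere) = ((0 : ℂ) : Sphere))
    (h : ¬ (IsTotallyInvariant f ((0 : ℂ) : Sphere) ∧ IsTotallyInvariant f ∞)) :
    (localG f ((0 : ℂ) : Sphere) ∞).Finite := by
  obtain ⟨b, s, c, hs, hc, hb, hbc, hfb⟩ := hf.exists_germ_hasLeadingTerm hN h0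
  have hmonomial : ¬ ∀ᶠ z in 𝓝 0, b z = c * z ^ s := by
    refine fun hbz => h (hf.isTotallyInvariant_of_germ_eq_monomial (s := s) (by omega) hc ?_)
    filter_upwards [hfb, hbz] with z h1 h2
    rw [h1, h2]
  have hmultipliers := finite_setOf_comp_const_mul_eq hb hc hbc hmonomial
  refine finite_of_finite_image_of_three (OnePoint.coe_ne_infty (0 : ℂ))
    (OnePoint.coe_injective.ne zero_ne_one) (OnePoint.infty_ne_coe (1 : ℂ))
    ((Set.finite_singleton ((0 : ℂ) : Sphere)).subset ?_)
    ((Set.finite_singleton (∞ : Sphere)).subset ?_)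
    ((hmultipliers.image ((↑) : ℂ → Sphere)).subset ?_)
  · exact Set.image_subset_iff.2 fun τ hτ => hτ.2.1
  · exact Set.image_subset_iff.2 fun τ hτ => hτ.2.2.1
  · rintro _ ⟨τ, ⟨-, hτ0, hτ1, m, -, hm⟩, rfl⟩
    obtain ⟨ε, hε, hτ⟩ := exists_homothety_of_smul_zero_infty hτ0 hτ1
    exact ⟨ε, ⟨hε, m, eventually_germ_equivariant hfb hτ hm⟩, by simp only [hτ, mul_one]⟩

lemma IsRational.finite_localG (hf : IsRational f N) (hN : N ≠ 0) {z₀ z₁ : Sphere} (hne : z₀ ≠ z₁)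
    (h0 : f z₀ = z₀) (h : ¬ (IsTotallyInvariant f z₀ ∧ IsTotallyInvariant f z₁)) :
    (localG f z₀ z₁).Finite := by
  obtain ⟨β, hβ0, hβ1⟩ := exists_smul_eq_zero_infty hne
  have hfin : (localG (conjMap β f) (β • z₀) (β • z₁)).Finite := by
    rw [← isTotallyInvariant_conjMap_smul β (w := z₀),
      ← isTotallyInvariant_conjMap_smul β (w := z₁), hβ0, hβ1] at h
    rw [hβ0, hβ1]
    exact (hf.conj β).finite_localG_zero_infty hN (by rw [← hβ0, conjMap_smul, h0]) h
  refine (hfin.preimage (MulAut.conj β).injective.injOn).subset fun τ hτ => ?_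
  exact (conj_mem_localG_iff β).2 hτ

end LocalSymmetries

section InfiniteSymmetryGroups

variable {f : Sphere → Sphere} {N : ℕ} {σ : Moebius} {z₀ z₁ : Sphere}

lemma finite_and_ncard_le_two_mul {T L : Set Moebius}
    (hT : ∀ τ ∈ T, ∀ τ' ∈ T, τ⁻¹ * τ' ∈ T) (hz : ∀ τ ∈ T, τ • z₀ = z₀ ∨ τ • z₀ = z₁)
    (hTL : ∀ τ ∈ T, τ • z₀ = z₀ → τ ∈ L) (hL : L.Finite) :
    T.Finite ∧ T.ncard ≤ 2 * L.ncard := by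
  obtain ⟨τ₀, hτ₀⟩ : ∃ τ₀ : Moebius, ∀ τ ∈ T, τ • z₀ = z₁ → τ₀⁻¹ * τ ∈ L := by
    by_cases h : ∃ τ ∈ T, τ • z₀ = z₁
    · obtain ⟨τ₀, hτ₀T, hτ₀⟩ := h
      refine ⟨τ₀, fun τ hτ hτ1 => hTL _ (hT _ hτ₀T _ hτ) ?_⟩
      rw [mul_smul, hτ1, inv_smul_eq_iff, hτ₀]
    · exact ⟨1, fun τ hτ hτ1 => absurd ⟨τ, hτ, hτ1⟩ h⟩
  have hsub : T ⊆ L ∪ (τ₀ * ·) '' L := fun τ hτ =>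
    (hz τ hτ).imp (hTL τ hτ) fun h => ⟨_, hτ₀ τ hτ h, mul_inv_cancel_left τ₀ τ⟩
  have hfin : (L ∪ (τ₀ * ·) '' L).Finite := hL.union (hL.image _)
  refine ⟨hfin.subset hsub, ?_⟩
  calc T.ncard ≤ (L ∪ (τ₀ * ·) '' L).ncard := Set.ncard_le_ncard hsub hfin
    _ ≤ L.ncard + ((τ₀ * ·) '' L).ncard := Set.ncard_union_le _ _
    _ ≤ 2 * L.ncard := by
      rw [two_mul]
      exact Nat.add_le_add_left (Set.ncard_image_le hL) _

lemma IsRational.finite_iUnion_and_ncard_le (hf : IsRational f N) (hN : 2 ≤ N)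
    {S : ℕ → Subgroup Moebius} (hSmul : ∀ i j, 1 ≤ i → 1 ≤ j → S i ≤ S (i * j))
    (hSfin : ∀ j, 1 ≤ j → (S j : Set Moebius).Finite)
    (hSequiv : ∀ j, ∀ τ ∈ S j, ∃ m : ℕ, ∀ z, f^[j] (τ • z) = τ ^ m • f^[j] z)
    (hσS : σ ∈ S 1) (hσ : 5 < orderOf σ) (hne : z₀ ≠ z₁)
    (hσ₀ : σ • z₀ = z₀) (hσ₁ : σ • z₁ = z₁) (h0 : f z₀ = z₀) (hL : (localG f z₀ z₁).Finite) :
    (⋃ j : ℕ, ⋃ _ : 1 ≤ j, (S j : Set Moebius)).Finite ∧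
      (⋃ j : ℕ, ⋃ _ : 1 ≤ j, (S j : Set Moebius)).ncard ≤ 2 * (localG f z₀ z₁).ncard := by
  have hσS' : ∀ j, 1 ≤ j → σ ∈ S j := fun j hj => one_mul j ▸ hSmul 1 j le_rfl hj hσS
  have hmem : ∀ τ : Moebius, τ ∈ (⋃ j : ℕ, ⋃ _ : 1 ≤ j, (S j : Set Moebius)) ↔
      ∃ j, 1 ≤ j ∧ τ ∈ S j := fun τ => by
    simp only [Set.mem_iUnion, SetLike.mem_coe, exists_prop]
  refine finite_and_ncard_le_two_mul (z₀ := z₀) (z₁ := z₁) ?_ ?_ ?_ hL <;> simp only [hmem]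
  · rintro τ ⟨i, hi, hτ⟩ τ' ⟨j, hj, hτ'⟩
    exact ⟨i * j, Nat.mul_pos hi hj,
      mul_mem (inv_mem (hSmul i j hi hj hτ)) (mul_comm j i ▸ hSmul j i hj hi hτ')⟩
  · rintro τ ⟨j, hj, hτ⟩
    exact smul_eq_or_eq_of_mem (hSfin j hj) (hσS' j hj) hσ hne hσ₀ hσ₁ hτ
  · rintro τ ⟨j, hj, hτ⟩ hτ0
    have hτ1 : τ • z₁ = z₁ :=
      (smul_eq_or_eq_of_mem (hSfin j hj) (hσS' j hj) hσ hne.symm hσ₁ hσ₀ hτ).resolve_right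
        fun h => hne (smul_left_cancel τ (hτ0.trans h.symm))
    obtain ⟨m, hm⟩ := hSequiv j τ hτ
    exact mem_localG_iff.2 ⟨hτ0, hτ1, hf.equivariant_of_iterate hN hne h0 hτ0 hτ1 hj hm⟩

lemma symAut_le_symAut_iterate (f : Sphere → Sphere) (j : ℕ) : symAut f ≤ symAut f^[j] :=
  fun τ (hτ : Function.Commute f (τ • ·)) z => hτ.iterate_left j z

lemma symSigma_le_symSigma_iterate (f : Sphere → Sphere) {j : ℕ} (hj : 1 ≤ j) :
    symSigma f ≤ symSigma f^[j] := fun τ (hτ : ∀ z, f (τ • z) = f z) z => by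
  obtain ⟨i, rfl⟩ := Nat.exists_eq_add_of_le' hj
  rw [Function.iterate_succ_apply, Function.iterate_succ_apply, hτ]

lemma iUnion_iterate_mul {S : (Sphere → Sphere) → Subgroup Moebius}
    (hS : ∀ g : Sphere → Sphere, ∀ j, 1 ≤ j → S g ≤ S g^[j]) {k : ℕ} (hk : 1 ≤ k) :
    ⋃ j : ℕ, ⋃ _ : 1 ≤ j, (S (f^[k])^[j] : Set Moebius) =
      ⋃ j : ℕ, ⋃ _ : 1 ≤ j, (S f^[j] : Set Moebius) := by
  refine Set.Subset.antisymm (Set.iUnion₂_subset fun j hj => ?_)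
    (Set.iUnion₂_subset fun j hj => ?_)
  · rw [← Function.iterate_mul]
    exact Set.subset_iUnion₂_of_subset (k * j) (Nat.mul_pos hk hj) subset_rfl
  · refine Set.subset_iUnion₂_of_subset j hj ?_
    rw [← Function.iterate_mul, mul_comm, Function.iterate_mul]
    exact hS _ k hk

lemma autInf_iterate (f : Sphere → Sphere) {k : ℕ} (hk : 1 ≤ k) : autInf f^[k] = autInf f :=
  iUnion_iterate_mul (S := symAut) (fun g j _ => symAut_le_symAut_iterate g j) hk

lemma sigmaInf_iterate (f : Sphere → Sphere) {k : ℕ} (hk : 1 ≤ k) :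
    sigmaInf f^[k] = sigmaInf f :=
  iUnion_iterate_mul (S := symSigma) (fun g _ hj => symSigma_le_symSigma_iterate g hj) hk

lemma IsRational.finite_autInf_and_ncard_le (hf : IsRational f N) (hN : 2 ≤ N)
    (hti : ∀ j, 1 ≤ j → ∀ w, w ≠ z₀ →
      ¬ (IsTotallyInvariant f^[j] z₀ ∧ IsTotallyInvariant f^[j] w))
    (hσS : σ ∈ symAut f) (hσ : 5 < orderOf σ) (hne : z₀ ≠ z₁) (hσ₀ : σ • z₀ = z₀)
    (hσ₁ : σ • z₁ = z₁) (h0 : f z₀ = z₀) (hL : (localG f z₀ z₁).Finite) :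
    (autInf f).Finite ∧ (autInf f).ncard ≤ 2 * (localG f z₀ z₁).ncard :=
  hf.finite_iUnion_and_ncard_le hN
    (fun i j _ _ => Function.iterate_mul f i j ▸ symAut_le_symAut_iterate f^[i] j)
    (fun j hj => (hf.iterate j).finite_symAut (hN.trans (Nat.le_self_pow (by omega) N))
      (Function.iterate_fixed h0 j) (hti j hj))
    (fun _ τ hτ => ⟨1, fun z => (hτ z).trans (by rw [pow_one])⟩)
    hσS hσ hne hσ₀ hσ₁ h0 hL

lemma IsRational.finite_sigmaInf_and_ncard_le (hf : IsRational f N) (hN : 2 ≤ N)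
    (hσS : σ ∈ symSigma f) (hσ : 5 < orderOf σ) (hne : z₀ ≠ z₁) (hσ₀ : σ • z₀ = z₀)
    (hσ₁ : σ • z₁ = z₁) (h0 : f z₀ = z₀) (hL : (localG f z₀ z₁).Finite) :
    (sigmaInf f).Finite ∧ (sigmaInf f).ncard ≤ 2 * (localG f z₀ z₁).ncard :=
  hf.finite_iUnion_and_ncard_le hN
    (fun i j _ hj => Function.iterate_mul f i j ▸ symSigma_le_symSigma_iterate f^[i] hj)
    (fun j _ => (hf.iterate j).finite_symSigma (pow_ne_zero j (by omega)))
    (fun _ τ hτ => ⟨0, fun z => (hτ z).trans (by rw [pow_zero, one_smul])⟩)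
    hσS hσ hne hσ₀ hσ₁ h0 hL

end InfiniteSymmetryGroups

end RationalDynamics

end

open RationalDynamics in
theorem theorem6p2 (A : RatFunc ℂ) (hdeg : 2 ≤ RationalDynamics.degree A)
    (hconj : ¬ RationalDynamics.IsConjugateToPower A)
    (k : ℕ) (hk : 1 ≤ k)
    (σ : RationalDynamics.Moebius) (hσ : 5 < orderOf σ)
    (z₀ z₁ : RationalDynamics.Sphere) (hne : z₀ ≠ z₁)
    (hσ₀ : σ • z₀ = z₀) (hσ₁ : σ • z₁ = z₁)
    (hfix : (RationalDynamics.toMap A)^[k] z₀ = z₀) :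
    (σ ∈ RationalDynamics.symAut (RationalDynamics.toMap A)^[k] →
      (RationalDynamics.autInf (RationalDynamics.toMap A)).Finite ∧
      (RationalDynamics.localG (RationalDynamics.toMap A)^[k] z₀ z₁).Finite ∧
      (RationalDynamics.autInf (RationalDynamics.toMap A)).ncard ≤
        2 * (RationalDynamics.localG (RationalDynamics.toMap A)^[k] z₀ z₁).ncard) ∧
    (σ ∈ RationalDynamics.symSigma (RationalDynamics.toMap A)^[k] →
      (RationalDynamics.sigmaInf (RationalDynamics.toMap A)).Finite ∧
      (RationalDynamics.localG (RationalDynamics.toMap A)^[k] z₀ z₁).Finite ∧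
      (RationalDynamics.sigmaInf (RationalDynamics.toMap A)).ncard ≤
        2 * (RationalDynamics.localG (RationalDynamics.toMap A)^[k] z₀ z₁).ncard) := by
  have hf := (isRational_toMap A).iterate k
  have hN : 2 ≤ degree A ^ k := hdeg.trans (Nat.le_self_pow (by omega) _)
  have hti (m : ℕ) (hm : 1 ≤ m) (w : Sphere) (hw : w ≠ z₀) :
      ¬ (IsTotallyInvariant (toMap A)^[m] z₀ ∧ IsTotallyInvariant (toMap A)^[m] w) :=
    fun h => hconj (isConjugateToPower_of_isTotallyInvariant_iterate hdeg hm hw.symm h.1 h.2)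
  have hL : (localG (toMap A)^[k] z₀ z₁).Finite :=
    hf.finite_localG (by omega) hne hfix (hti k hk z₁ hne.symm)
  rw [← autInf_iterate (toMap A) hk, ← sigmaInf_iterate (toMap A) hk]
  refine ⟨fun hσA => ?_, fun hσS => ?_⟩
  · have hti' (j : ℕ) (hj : 1 ≤ j) := Function.iterate_mul (toMap A) k j ▸ hti _ (Nat.mul_pos hk hj)
    have h := hf.finite_autInf_and_ncard_le hN hti' hσA hσ hne hσ₀ hσ₁ hfix hL
    exact ⟨h.1, hL, h.2⟩
  · have h := hf.finite_sigmaInf_and_ncard_le hN hσS hσ hne hσ₀ hσ₁ hfix hL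
    exact ⟨h.1, hL, h.2⟩
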